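/- **Setting.** For $f,g:\mathbb R^p\times\mathbb R^q\to\mathbb R$ with $g(x,\cdot)$ strongly convex put $y^*(x)=\arg\min_y g(x,y)$ and $\Phi(x)=f(x,y^*(x))$. Given constants $L_x,L_{xy},L_y,\widetilde L_{xy},\widetilde L_y,\rho_{xy},\rho_{yy},\mu_x,\mu_y,B$, the class $\mathcal F_{scsc}$ consists of the pairs $(f,g)$, $f$ of class $C^1$ and $g$ of class $C^2$, such that - $\nabla_x f$ is $L_x$-Lipschitz in $x$ and $L_{xy}$-Lipschitz in $y$; $\nabla_y f$ is $L_{xy}$-Lipschitz in $x$ and $L_y$-Lipschitz in $y$; $\nabla_y g$ is $\widetilde L_{xy}$-Lipschitz in $x$ and $\widetilde L_y$-Lipschitz in $y$; - $\nabla_x\nabla_y g$ and $\nabla_y^2 g$ are $\rho_{xy}$- and $\rho_{yy}$-Lipschitz in $(x,y)$; - $g(x,\cdot)$ is $\mu_y$-strongly convex for every $x$, $\Phi$ is $\mu_x$-strongly convex, and its minimiser $x^*$ has norm $\|x^*\|=B$. **Algorithm class.** An algorithm runs $K$ iterations and updates $x$ at $Q$ of them, $s_0<\dots<s_{Q-1}\le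 K$; it has a parameter $T\in\mathbb N$. Its iterates satisfy $x^k\in\mathcal H_x^k$, $y^k\in\mathcal H_y^k$, where $\mathcal H_x^0=\mathcal H_y^0=\{0\}$ (so $x_0=0$), $$\mathcal H_y^{k+1}=\mathrm{Span}\{y_i,\ \nabla_y g(\tilde x_i,\tilde y_i)\ :\ 0\le i\le k\},$$ $$\mathcal H_x^{s_m}=\mathrm{Span}\Big\{x_i,\ \nabla_x f(\tilde x_i,\tilde y_i),\ \nabla_x\nabla_y g(x_i^t,y_i^t)\prod_{j=1}^t\big(I-\alpha\nabla_y^2 g(x_{i,j}^t,y_{i,j}^t)\big)\nabla_y f(\hat x_i,\hat y_i)\ :\ 0\le i\le s_m-1,\ 0\le t\le T,\ \alpha\in\mathbb R\Big\}$$ for $s_m\ge 1$; here all $x$-points with index $i$ range over $\mathcal H_x^i$ and all $y$-points with index $i$ over $\mathcal H_y^i$; and $\mathcal H_x^n=\mathcal H_x^{n-1}$ if $x$ is not updated at iteration $n\ge1$. The output is any $x^K\in\mathcal H_x^K$. Put $M=K+QT+Q+2$. The complexity is $\mathcal C=\tau(n_J+n_H)+n_G$, where $\tau>0$ is a universal constant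 and the numbers of Jacobian-vector products, Hessian-vector products and gradient evaluations are counted as $n_J=Q$, $n_H=QT$, $n_G=K$. **Theorem.** Let $L_x,L_y,\widetilde L_{xy},\widetilde L_y,\tau>0$ and $L_{xy}\in\mathbb R$. There are constants $c_1,\dots,c_5>0$, depending only on these six numbers, such that for all $0<\mu_x\le L_x$ and $0<\mu_y\le\widetilde L_y$ with $L_{xy}\ge\frac{(L_x-\mu_x)(\widetilde L_y-\mu_y)}{2\widetilde L_{xy}}$ there are reals $r,\xi$ with $$\xi\ \ge\ \frac{\widetilde L_y}{4\mu_y}+\frac{L_x}{8\mu_x}+\frac{L_y\widetilde L_{xy}^2}{8\mu_x\mu_y^2}-\frac38\ \ge\ \frac{c_1}{\mu_x\mu_y^2},\qquad 1-\Big(\tfrac12+\sqrt{\xi+\tfrac14}\Big)^{-1}<r<1,$$ such that the following holds for all $\rho_{xy},\rho_{yy}\ge0$ and $B>0$. There is a function $D:\mathbb R\to\mathbb N$ such that for every $d\ge5$ there is an instance $(f,g)\in\mathcal F_{scsc}$ with $p=q=d$, where $$f(x,y)=\tfrac12x^TAx+x^TCy+\tfrac12y^TEy+u^Tx+v^Ty,\qquad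 g(x,y)=\tfrac12y^THy+x^TJy+b^Ty,$$ $u,v,b\in\mathbb R^d$, and the matrices $A,C,E,H,J$ are polynomials in the $d\times d$ coupling matrix $Z$ with $Z_{ij}=1$ if $i+j=d+1$, $Z_{ij}=-1$ if $i+j=d+2$, and $Z_{ij}=0$ otherwise ($1\le i,j\le d$), with the following two properties. 1. For every algorithm of the class with $d>\max\{2M,\ M+1+\log_r(c_2\mu_x\mu_y^2)\}$ and every output $x^K$ of it, $$\Phi(x^K)-\Phi(x^*)\ \ge\ c_3\,\mu_x\mu_y^2\,(\Phi(x_0)-\Phi(x^*))\,r^{2M}.$$ 2. For every $\varepsilon$ with $0<\varepsilon\le c_4\,\mu_x\mu_y^2(\Phi(x_0)-\Phi(x^*))$ and $d\ge D(\varepsilon)$, every algorithm of the class with an output satisfying $\Phi(x^K)-\Phi(x^*)\le\varepsilon$ has complexity $$\mathcal C\ \ge\ c_5\sqrt{\frac{L_y\widetilde L_{xy}^2}{\mu_x\mu_y^2}}\ \log\frac{\mu_x\mu_y^2(\Phi(x_0)-\Phi(x^*))}{\varepsilon}.$$ -/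

import Mathlib

/-- The inner solution `argmin_y g(x, y)`: a minimiser of `g x`, the unique one when
`g x` is strongly convex and continuous on a finite-dimensional space. -/
noncomputable def innerArgmin {X Y : Type*} [NormedAddCommGroup Y]
    (g : X → Y → ℝ) (x : X) : Y :=
  Classical.epsilon fun y => IsMinOn (g x) Set.univ y

/-- The total objective `Φ(x) = f(x, y*(x))`, `y*(x) = argmin_y g(x, y)`. -/
noncomputable def totalObjective {X Y : Type*} [NormedAddCommGroup Y]
    (f g : X → Y → ℝ) (x : X) : ℝ :=
  f x (innerArgmin g x)

section Derivatives

variable {X Y : Type*}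
  [NormedAddCommGroup X] [InnerProductSpace ℝ X] [CompleteSpace X]
  [NormedAddCommGroup Y] [InnerProductSpace ℝ Y] [CompleteSpace Y]

/-- `∇_x h(x, y)`. -/
noncomputable def gradX (h : X → Y → ℝ) (x : X) (y : Y) : X :=
  gradient (fun x' => h x' y) x

/-- `∇_y h(x, y)`. -/
noncomputable def gradY (h : X → Y → ℝ) (x : X) (y : Y) : Y :=
  gradient (fun y' => h x y') y

/-- The `p × q` matrix `∇_x ∇_y h(x, y)` of mixed second derivatives, as a linear map from the
`y`-space to the `x`-space, `v ↦ ∂_y (∇_x h)(x, y) v`. -/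
noncomputable def jacXY (h : X → Y → ℝ) (x : X) (y : Y) : Y →L[ℝ] X :=
  fderiv ℝ (fun y' => gradX h x y') y

/-- The Hessian `∇_y² h(x, y)`. -/
noncomputable def hessY (h : X → Y → ℝ) (x : X) (y : Y) : Y →L[ℝ] Y :=
  fderiv ℝ (fun y' => gradY h x y') y

/-- The strongly-convex–strongly-convex class of bilevel problems, with smoothness constants
`Lx, Lxy, Ly` of `f`, `Lgxy, Lgy` of `g`, Lipschitz constants `ρxy, ρyy` of the second derivatives
of `g`, strong convexity constants `μx` of `Φ` and `μy` of `g(x, ·)`, and norm `B` of the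
minimiser of `Φ`. -/
structure SCSCClass (Lx Lxy Ly Lgxy Lgy ρxy ρyy μx μy B : ℝ) (f g : X → Y → ℝ) : Prop where
  contDiff_f : ContDiff ℝ 1 fun z : X × Y => f z.1 z.2
  contDiff_g : ContDiff ℝ 2 fun z : X × Y => g z.1 z.2
  gradX_f_x : ∀ x₁ x₂ y, ‖gradX f x₁ y - gradX f x₂ y‖ ≤ Lx * ‖x₁ - x₂‖
  gradX_f_y : ∀ x y₁ y₂, ‖gradX f x y₁ - gradX f x y₂‖ ≤ Lxy * ‖y₁ - y₂‖
  gradY_f_x : ∀ x₁ x₂ y, ‖gradY f x₁ y - gradY f x₂ y‖ ≤ Lxy * ‖x₁ - x₂‖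
  gradY_f_y : ∀ x y₁ y₂, ‖gradY f x y₁ - gradY f x y₂‖ ≤ Ly * ‖y₁ - y₂‖
  gradY_g_x : ∀ x₁ x₂ y, ‖gradY g x₁ y - gradY g x₂ y‖ ≤ Lgxy * ‖x₁ - x₂‖
  gradY_g_y : ∀ x y₁ y₂, ‖gradY g x y₁ - gradY g x y₂‖ ≤ Lgy * ‖y₁ - y₂‖
  jacXY_g : ∀ x₁ x₂ y₁ y₂, ‖jacXY g x₁ y₁ - jacXY g x₂ y₂‖ ≤
    ρxy * Real.sqrt (‖x₁ - x₂‖ ^ 2 + ‖y₁ - y₂‖ ^ 2)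
  hessY_g : ∀ x₁ x₂ y₁ y₂, ‖hessY g x₁ y₁ - hessY g x₂ y₂‖ ≤
    ρyy * Real.sqrt (‖x₁ - x₂‖ ^ 2 + ‖y₁ - y₂‖ ^ 2)
  strongConvex_g : ∀ x, StrongConvexOn Set.univ μy (g x)
  strongConvex_total : StrongConvexOn Set.univ μx (totalObjective f g)
  exists_minimiser : ∃ x, IsMinOn (totalObjective f g) Set.univ x ∧ ‖x‖ = B

/-- The directions contributed to the `y`-search space by points of given search spaces. -/
def yGenerators (g : X → Y → ℝ) (Hx : Submodule ℝ X) (Hy : Submodule ℝ Y) : Set Y :=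
  {v | v ∈ Hy ∨ ∃ x ∈ Hx, ∃ y ∈ Hy, v = gradY g x y}

/-- The directions contributed to the `x`-search space by points of given search spaces:
the points themselves, the gradients `∇_x f`, and the products
`∇_x∇_y g · ∏_{j=1}^t (I - α ∇_y² g) · ∇_y f`, `0 ≤ t ≤ T`, `α` real, where all the derivatives
are evaluated at arbitrary, possibly different points of the search spaces. -/
def xGenerators (f g : X → Y → ℝ) (T : ℕ) (Hx : Submodule ℝ X) (Hy : Submodule ℝ Y) : Set X :=
  {v | v ∈ Hx ∨ (∃ x ∈ Hx, ∃ y ∈ Hy, v = gradX f x y) ∨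
    ∃ (t : ℕ) (α : ℝ) (a c : X × Y) (z : Fin t → X × Y), t ≤ T ∧
      (a.1 ∈ Hx ∧ a.2 ∈ Hy) ∧ (c.1 ∈ Hx ∧ c.2 ∈ Hy) ∧ (∀ j, (z j).1 ∈ Hx ∧ (z j).2 ∈ Hy) ∧
      v = jacXY g a.1 a.2
        ((List.ofFn fun j => (1 : Y →L[ℝ] Y) - α • hessY g (z j).1 (z j).2).prod
          (gradY f c.1 c.2))}

open scoped Classical in
/-- The search spaces `(H_x^k, H_y^k)`, where `upd` is the set of the iterations at which `x` is
updated: both are `{0}` at `k = 0`, `H_y^{k+1}` is spanned by the directions contributed by the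
search spaces with indices `0, …, k`, and so is `H_x^{k+1}` if `x` is updated at iteration `k + 1`;
otherwise `H_x^{k+1} = H_x^k`. -/
noncomputable def searchSpaces (f g : X → Y → ℝ) (T : ℕ) (upd : Set ℕ) :
    ℕ → Submodule ℝ X × Submodule ℝ Y
  | 0 => (⊥, ⊥)
  | k + 1 =>
    (if k + 1 ∈ upd then
        Submodule.span ℝ (⋃ i : Fin (k + 1),
          xGenerators f g T (searchSpaces f g T upd i).1 (searchSpaces f g T upd i).2)
      else (searchSpaces f g T upd k).1,
      Submodule.span ℝ (⋃ i : Fin (k + 1),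
        yGenerators g (searchSpaces f g T upd i).1 (searchSpaces f g T upd i).2))
  termination_by n => n
  decreasing_by all_goals first | exact i.2 | omega

end Derivatives

/-- The parameters of an algorithm of the hypergradient-based class: `K` iterations, `x` is updated
`Q` times, at the iterations `s 0 < s 1 < … ≤ K`, and every hypergradient estimate uses at most `T`
Hessian-vector products. -/
structure AlgorithmSchedule where
  K : ℕ
  T : ℕ
  Q : ℕ
  s : Fin Q → ℕ
  strictMono_s : StrictMono s
  s_le : ∀ i, s i ≤ K

namespace AlgorithmSchedule

/-- `M = K + QT + Q + 2`. -/
def M (S : AlgorithmSchedule) : ℕ := S.K + S.Q * S.T + S.Q + 2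

/-- The complexity `τ (n_J + n_H) + n_G` with `n_J = Q` Jacobian-vector products, `n_H = QT`
Hessian-vector products and `n_G = K` gradient evaluations. -/
def complexity (S : AlgorithmSchedule) (τ : ℝ) : ℝ :=
  τ * ((S.Q : ℝ) + (S.Q : ℝ) * (S.T : ℝ)) + (S.K : ℝ)

/-- The subspace `H_x^K` that contains the output `x^K`. -/
noncomputable def outputSpace {X Y : Type*}
    [NormedAddCommGroup X] [InnerProductSpace ℝ X] [CompleteSpace X]
    [NormedAddCommGroup Y] [InnerProductSpace ℝ Y] [CompleteSpace Y]
    (S : AlgorithmSchedule) (f g : X → Y → ℝ) : Submodule ℝ X :=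
  (searchSpaces f g S.T (Set.range S.s) S.K).1

end AlgorithmSchedule

/-- The coupling matrix: `1` on the antidiagonal, `-1` directly below it, `0` elsewhere. -/
def couplingMatrix (d : ℕ) : Matrix (Fin d) (Fin d) ℝ :=
  Matrix.of fun i j =>
    if (i : ℕ) + j + 1 = d then 1 else if (i : ℕ) + j = d then -1 else 0

/-- The operator `p(Z)` on `ℝ^d`, for a polynomial `p` and the coupling matrix `Z`. -/
noncomputable def couplingOp (d : ℕ) (p : Polynomial ℝ) :
    EuclideanSpace ℝ (Fin d) →ₗ[ℝ] EuclideanSpace ℝ (Fin d) :=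
  Matrix.toEuclideanLin (Polynomial.aeval (couplingMatrix d) p)

/-- `f` and `g` are quadratic functions,
`f(x,y) = ½ xᵀA x + xᵀC y + ½ yᵀE y + uᵀx + vᵀy` and `g(x,y) = ½ yᵀH y + xᵀJ y + bᵀy`,
whose matrices `A, C, E, H, J` are polynomials in the coupling matrix. -/
def IsCoupledQuadratic {d : ℕ}
    (f g : EuclideanSpace ℝ (Fin d) → EuclideanSpace ℝ (Fin d) → ℝ) : Prop :=
  ∃ (A C E H J : Polynomial ℝ) (u v b : EuclideanSpace ℝ (Fin d)),
    (∀ x y, f x y = 1 / 2 * inner ℝ x (couplingOp d A x) + inner ℝ x (couplingOp d C y)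
      + 1 / 2 * inner ℝ y (couplingOp d E y) + inner ℝ u x + inner ℝ v y) ∧
    (∀ x y, g x y = 1 / 2 * inner ℝ y (couplingOp d H y) + inner ℝ x (couplingOp d J y)
      + inner ℝ b y)

/-! The hard instance is quadratic, and all its matrices are polynomials in the symmetric coupling
matrix `Z`, with `‖Z‖ ≤ 2`. Its square `Z²` is tridiagonal, the Laplacian of a path, so one
application of it moves the support of a vector by at most one coordinate.

With `H = βZ² + μy` and `K = H⁻¹`, the matrices `A = αZ² + μx`, `C = -(αβ/L)Z³`, `E = Ly`, `J =
-(L/2)Z` give `∇²Φ = K² P(Z²)` for a quadratic `P`: the cubic `C` cancels what would be a cubic term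
of `P` (`totalHess_eq`). The discriminant of `P` is positive, so `P(t) = (q t + k)(t + s)` with `s >
0` of order at most `μx μy²`. The linear terms `b`, `v` are chosen so that stationarity of `Φ`
reduces to `(Z² + s) x = ω e₁`. The solution decays like `r ^ i`, where `(1 - r)² = s r`.

An algorithm starts from zero. Although `Z` itself swaps the two ends of the coordinate range, the
`x`-space and the image under `Z` of the `y`-space stay among vectors supported on an initial
segment, which grows by 1 per iteration and by a further `T + 1` per update of `x`
(`searchSpaces_le`). The output thus lives on the first `M - 1` coordinates, and its distance to the
minimiser is at least the tail of a geometric sequence (`norm_sq_sub_decayVec_ge`). Strong convexity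
of `Φ` turns this into a gap of order `r ^ (2M)`. Since `-log r ≤ √s`, taking logarithms bounds `M`,
and with it the complexity. -/

/-! ### Bilevel problems with quadratic levels -/

section QuadraticFunctions

variable {V : Type*} [NormedAddCommGroup V] [InnerProductSpace ℝ V]

/-- The quadratic function `½⟪x, T x⟫ + ⟪w, x⟫ + c`. -/
noncomputable def quadFun (T : V →L[ℝ] V) (w : V) (c : ℝ) (x : V) : ℝ :=
  1 / 2 * inner ℝ x (T x) + inner ℝ w x + c

lemma strongConvexOn_quadFun {T : V →L[ℝ] V} {m : ℝ} (h : ∀ x, m * ‖x‖ ^ 2 ≤ inner ℝ x (T x))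
    (w : V) (c : ℝ) : StrongConvexOn Set.univ m (quadFun T w c) := by
  refine ⟨convex_univ, fun x _ y _ a b ha hb hab => ?_⟩
  obtain rfl : b = 1 - a := by linarith
  have h1 := mul_le_mul_of_nonneg_left (h (x - y)) (mul_nonneg ha hb)
  simp only [quadFun, map_add, map_sub, map_smul, inner_add_left, inner_add_right, inner_sub_left,
    inner_sub_right, inner_smul_left, inner_smul_right, smul_eq_mul, RCLike.conj_to_real] at h1 ⊢
  nlinarith [h1]

lemma quadFun_sub_quadFun {T : V →L[ℝ] V} (hT : ∀ x y, inner ℝ (T x) y = inner ℝ x (T y))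
    {w x₀ : V} (h₀ : T x₀ + w = 0) (c : ℝ) (x : V) :
    quadFun T w c x - quadFun T w c x₀ = 1 / 2 * inner ℝ (x - x₀) (T (x - x₀)) := by
  obtain rfl : w = -T x₀ := by rw [eq_neg_iff_add_eq_zero, add_comm, h₀]
  have h1 : inner ℝ (T x₀) x = inner ℝ x (T x₀) := real_inner_comm _ _
  simp only [quadFun, map_sub, inner_sub_left, inner_sub_right, inner_neg_left]
  rw [← hT x₀ x, ← hT x₀ x₀, h1]
  ring

lemma hasGradientAt_quadFun [CompleteSpace V] {T : V →L[ℝ] V}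
    (hT : ∀ x y, inner ℝ (T x) y = inner ℝ x (T y)) (w : V) (c : ℝ) (x : V) :
    HasGradientAt (quadFun T w c) (T x + w) x := by
  rw [hasGradientAt_iff_hasFDerivAt]
  have h1 : HasFDerivAt (fun x : V => inner ℝ x (T x)) _ x :=
    (hasFDerivAt_id x).inner ℝ T.hasFDerivAt
  have h2 : HasFDerivAt (fun x : V => inner ℝ w x) (innerSL ℝ w) x := (innerSL ℝ w).hasFDerivAt
  refine (((h1.const_mul (1 / 2)).add h2).add_const c).congr_fderiv ?_
  ext z
  have h3 : inner ℝ z (T x) = inner ℝ (T x) z := real_inner_comm _ _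
  simp [fderivInnerCLM_apply, h3, ← hT x z]
  ring

lemma gradient_quadFun [CompleteSpace V] {T : V →L[ℝ] V}
    (hT : ∀ x y, inner ℝ (T x) y = inner ℝ x (T y)) (w : V) (c : ℝ) (x : V) :
    gradient (quadFun T w c) x = T x + w :=
  (hasGradientAt_quadFun hT w c x).gradient

/-- The upper-level objective `½⟪x, Ax⟫ + ⟪x, Cy⟫ + ½⟪y, Ey⟫ + ⟪u, x⟫ + ⟪v, y⟫`. -/
noncomputable def quadUpper (A C E : V →L[ℝ] V) (u v x y : V) : ℝ :=
  1 / 2 * inner ℝ x (A x) + inner ℝ x (C y) + 1 / 2 * inner ℝ y (E y) + inner ℝ u x + inner ℝ v y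

/-- The lower-level objective `½⟪y, Hy⟫ + ⟪x, Jy⟫ + ⟪b, y⟫`. -/
noncomputable def quadLower (H J : V →L[ℝ] V) (b x y : V) : ℝ :=
  1 / 2 * inner ℝ y (H y) + inner ℝ x (J y) + inner ℝ b y

variable {A C E H J : V →L[ℝ] V} {u v b : V}

lemma contDiff_quadUpper {n : WithTop ℕ∞} :
    ContDiff ℝ n fun z : V × V => quadUpper A C E u v z.1 z.2 := by
  unfold quadUpper
  have h1 : ContDiff ℝ n fun z : V × V => z.1 := contDiff_fst
  have h2 : ContDiff ℝ n fun z : V × V => z.2 := contDiff_snd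
  exact ((((contDiff_const.mul (h1.inner ℝ (A.contDiff.comp h1))).add
    (h1.inner ℝ (C.contDiff.comp h2))).add (contDiff_const.mul
    (h2.inner ℝ (E.contDiff.comp h2)))).add (contDiff_const.inner ℝ h1)).add
    (contDiff_const.inner ℝ h2)

lemma contDiff_quadLower {n : WithTop ℕ∞} :
    ContDiff ℝ n fun z : V × V => quadLower H J b z.1 z.2 := by
  unfold quadLower
  have h1 : ContDiff ℝ n fun z : V × V => z.1 := contDiff_fst
  have h2 : ContDiff ℝ n fun z : V × V => z.2 := contDiff_snd
  exact ((contDiff_const.mul (h2.inner ℝ (H.contDiff.comp h2))).add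
    (h1.inner ℝ (J.contDiff.comp h2))).add (contDiff_const.inner ℝ h2)

lemma quadLower_eq_quadFun (hJ : ∀ x y, inner ℝ (J x) y = inner ℝ x (J y)) (x : V) :
    quadLower H J b x = quadFun H (J x + b) 0 := by
  ext z
  simp only [quadLower, quadFun, inner_add_left, hJ]
  ring

/-- The minimiser of a coercive quadratic function is its stationary point. -/
lemma isMinOn_quadFun_iff {T : V →L[ℝ] V} (hT : ∀ x y, inner ℝ (T x) y = inner ℝ x (T y))
    {m : ℝ} (hm : 0 < m) (h : ∀ x, m * ‖x‖ ^ 2 ≤ inner ℝ x (T x))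
    {w x₀ : V} (h₀ : T x₀ + w = 0) (c : ℝ) (x : V) :
    IsMinOn (quadFun T w c) Set.univ x ↔ x = x₀ := by
  constructor
  · intro hx
    have h1 := quadFun_sub_quadFun hT h₀ c x
    have h2 : quadFun T w c x ≤ quadFun T w c x₀ := hx (Set.mem_univ x₀)
    have h3 : ‖x - x₀‖ ^ 2 ≤ 0 := by
      have := h (x - x₀)
      by_contra! h4
      nlinarith [mul_pos hm h4]
    have h4 : ‖x - x₀‖ = 0 := by nlinarith [norm_nonneg (x - x₀)]
    exact sub_eq_zero.1 (norm_eq_zero.1 h4)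
  · rintro rfl y -
    have h1 := quadFun_sub_quadFun hT h₀ c y
    have h2 := (mul_nonneg hm.le (sq_nonneg ‖y - x‖)).trans (h (y - x))
    simp only [Set.mem_ofPred_eq]
    linarith

lemma innerArgmin_quadLower (hH : ∀ x y, inner ℝ (H x) y = inner ℝ x (H y))
    (hJ : ∀ x y, inner ℝ (J x) y = inner ℝ x (J y)) {m : ℝ} (hm : 0 < m)
    (h : ∀ x, m * ‖x‖ ^ 2 ≤ inner ℝ x (H x)) {x y : V} (hy : H y + (J x + b) = 0) :
    innerArgmin (quadLower H J b) x = y := by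
  rw [innerArgmin, quadLower_eq_quadFun hJ]
  exact (isMinOn_quadFun_iff hH hm h hy 0 _).1
    (Classical.epsilon_spec ⟨y, (isMinOn_quadFun_iff hH hm h hy 0 _).2 rfl⟩)

/-- The total objective of a bilevel problem with quadratic levels, the lower one with inverse
Hessian `K`, is quadratic. -/
lemma totalObjective_quad (hH : ∀ x y, inner ℝ (H x) y = inner ℝ x (H y))
    (hJ : ∀ x y, inner ℝ (J x) y = inner ℝ x (J y)) {m : ℝ} (hm : 0 < m)
    (h : ∀ x, m * ‖x‖ ^ 2 ≤ inner ℝ x (H x)) {K : V →L[ℝ] V} (hHK : ∀ x, H (K x) = x)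
    (hE : ∀ x y, inner ℝ (E x) y = inner ℝ x (E y))
    (hK : ∀ x y, inner ℝ (K x) y = inner ℝ x (K y)) :
    totalObjective (quadUpper A C E u v) (quadLower H J b) =
      quadFun (A - (2 : ℝ) • (C * K * J) + J * K * E * K * J)
        (u - C (K b) + J (K (E (K b))) - J (K v))
        (1 / 2 * inner ℝ (K b) (E (K b)) - inner ℝ v (K b)) := by
  ext x
  have h1 : innerArgmin (quadLower H J b) x = -K (J x + b) :=
    innerArgmin_quadLower hH hJ hm h (by rw [map_neg, hHK, neg_add_cancel])
  have h2 : ∀ z, inner ℝ (J (K z)) x = inner ℝ z (K (J x)) := fun z => by rw [hJ, hK]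
  have h3 : ∀ z, inner ℝ x (J (K z)) = inner ℝ z (K (J x)) := fun z => by
    rw [real_inner_comm, h2]
  have h4 : inner ℝ (K (J x)) (E (K b)) = inner ℝ (K b) (E (K (J x))) := by
    rw [← hE, real_inner_comm]
  simp only [totalObjective, h1, quadUpper, quadFun, map_add, map_neg, inner_add_left,
    inner_add_right, inner_neg_left, inner_neg_right, add_apply,
    sub_apply, smul_apply, mul_apply_eq_comp,
    inner_sub_left, inner_sub_right, inner_smul_right, h2, h3, h4, hE, real_inner_comm x (C (K b))]
  ring

variable [CompleteSpace V]

lemma gradX_quadUpper (hA : ∀ x y, inner ℝ (A x) y = inner ℝ x (A y)) (x y : V) :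
    gradX (quadUpper A C E u v) x y = A x + (C y + u) := by
  rw [← gradient_quadFun hA (C y + u) (1 / 2 * inner ℝ y (E y) + inner ℝ v y), gradX]
  congr 1
  ext z
  simp only [quadUpper, quadFun, inner_add_left, real_inner_comm z (C y)]
  ring

lemma gradY_quadUpper (hE : ∀ x y, inner ℝ (E x) y = inner ℝ x (E y))
    (hC : ∀ x y, inner ℝ (C x) y = inner ℝ x (C y)) (x y : V) :
    gradY (quadUpper A C E u v) x y = E y + (C x + v) := by
  rw [← gradient_quadFun hE (C x + v) (1 / 2 * inner ℝ x (A x) + inner ℝ u x), gradY]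
  congr 1
  ext z
  simp only [quadUpper, quadFun, inner_add_left, hC]
  ring

lemma gradX_quadLower (x y : V) : gradX (quadLower H J b) x y = J y := by
  have h := gradient_quadFun (T := (0 : V →L[ℝ] V)) (by simp) (J y)
    (1 / 2 * inner ℝ y (H y) + inner ℝ b y) x
  simp only [zero_apply, zero_add] at h
  rw [← h, gradX]
  congr 1
  ext z
  simp only [quadLower, quadFun, real_inner_comm z (J y), zero_apply,
    inner_zero_right]
  ring

lemma gradY_quadLower (hH : ∀ x y, inner ℝ (H x) y = inner ℝ x (H y))
    (hJ : ∀ x y, inner ℝ (J x) y = inner ℝ x (J y)) (x y : V) :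
    gradY (quadLower H J b) x y = H y + (J x + b) := by
  rw [← gradient_quadFun hH (J x + b) 0, gradY]
  congr 1
  ext z
  simp only [quadLower, quadFun, inner_add_left, hJ]
  ring

lemma jacXY_quadLower (x y : V) : jacXY (quadLower H J b) x y = J := by
  simp only [jacXY, gradX_quadLower]
  exact J.fderiv

lemma hessY_quadLower (hH : ∀ x y, inner ℝ (H x) y = inner ℝ x (H y))
    (hJ : ∀ x y, inner ℝ (J x) y = inner ℝ x (J y)) (x y : V) :
    hessY (quadLower H J b) x y = H := by
  simp only [hessY, gradY_quadLower hH hJ]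
  rw [fderiv_add_const]
  exact H.fderiv

end QuadraticFunctions

/-! ### Class membership, and the Hessian of `Φ` for polynomials in `Z` -/

section CoupledQuadratics

variable {V : Type*} [NormedAddCommGroup V] [InnerProductSpace ℝ V]

/-- Gradients of quadratics are affine, so every Lipschitz condition is a norm bound on one matrix;
the second derivatives are constant, which makes any nonnegative `ρxy`, `ρyy` admissible. -/
lemma quad_memSCSCClass [CompleteSpace V] {A C E H J T : V →L[ℝ] V} {u v b w xs : V}
    {Lx Lxy Ly Lgxy Lgy ρxy ρyy μx μy c : ℝ}
    (hA : ∀ x y, inner ℝ (A x) y = inner ℝ x (A y))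
    (hC : ∀ x y, inner ℝ (C x) y = inner ℝ x (C y))
    (hE : ∀ x y, inner ℝ (E x) y = inner ℝ x (E y))
    (hH : ∀ x y, inner ℝ (H x) y = inner ℝ x (H y))
    (hJ : ∀ x y, inner ℝ (J x) y = inner ℝ x (J y))
    (nA : ∀ x, ‖A x‖ ≤ Lx * ‖x‖) (nC : ∀ x, ‖C x‖ ≤ Lxy * ‖x‖) (nE : ∀ x, ‖E x‖ ≤ Ly * ‖x‖)
    (nH : ∀ x, ‖H x‖ ≤ Lgy * ‖x‖) (nJ : ∀ x, ‖J x‖ ≤ Lgxy * ‖x‖)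
    (hρxy : 0 ≤ ρxy) (hρyy : 0 ≤ ρyy)
    (cH : ∀ x, μy * ‖x‖ ^ 2 ≤ inner ℝ x (H x))
    (hΦ : totalObjective (quadUpper A C E u v) (quadLower H J b) = quadFun T w c)
    (cT : ∀ x, μx * ‖x‖ ^ 2 ≤ inner ℝ x (T x))
    (hxs : IsMinOn (totalObjective (quadUpper A C E u v) (quadLower H J b)) Set.univ xs) :
    SCSCClass Lx Lxy Ly Lgxy Lgy ρxy ρyy μx μy ‖xs‖ (quadUpper A C E u v) (quadLower H J b) where
  contDiff_f := contDiff_quadUpper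
  contDiff_g := contDiff_quadLower
  gradX_f_x x₁ x₂ y := by
    rw [gradX_quadUpper hA, gradX_quadUpper hA, add_sub_add_right_eq_sub, ← map_sub]
    exact nA _
  gradX_f_y x y₁ y₂ := by
    rw [gradX_quadUpper hA, gradX_quadUpper hA, add_sub_add_left_eq_sub, add_sub_add_right_eq_sub,
      ← map_sub]
    exact nC _
  gradY_f_x x₁ x₂ y := by
    rw [gradY_quadUpper hE hC, gradY_quadUpper hE hC, add_sub_add_left_eq_sub,
      add_sub_add_right_eq_sub, ← map_sub]
    exact nC _
  gradY_f_y x y₁ y₂ := by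
    rw [gradY_quadUpper hE hC, gradY_quadUpper hE hC, add_sub_add_right_eq_sub, ← map_sub]
    exact nE _
  gradY_g_x x₁ x₂ y := by
    rw [gradY_quadLower hH hJ, gradY_quadLower hH hJ, add_sub_add_left_eq_sub,
      add_sub_add_right_eq_sub, ← map_sub]
    exact nJ _
  gradY_g_y x y₁ y₂ := by
    rw [gradY_quadLower hH hJ, gradY_quadLower hH hJ, add_sub_add_right_eq_sub, ← map_sub]
    exact nH _
  jacXY_g x₁ x₂ y₁ y₂ := by
    rw [jacXY_quadLower, jacXY_quadLower, sub_self, norm_zero]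
    positivity
  hessY_g x₁ x₂ y₁ y₂ := by
    rw [hessY_quadLower hH hJ, hessY_quadLower hH hJ, sub_self, norm_zero]
    positivity
  strongConvex_g x := by
    rw [quadLower_eq_quadFun hJ]
    exact strongConvexOn_quadFun cH _ _
  strongConvex_total := by
    rw [hΦ]
    exact strongConvexOn_quadFun cT _ _
  exists_minimiser := ⟨xs, hxs, rfl⟩

lemma norm_le_of_coercive {H : V →L[ℝ] V} {m : ℝ} (cH : ∀ x, m * ‖x‖ ^ 2 ≤ inner ℝ x (H x))
    (x : V) : m * ‖x‖ ≤ ‖H x‖ := by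
  rcases (norm_nonneg x).eq_or_lt with h | h
  · rw [← h, mul_zero]
    exact norm_nonneg _
  · have h1 := (cH x).trans (real_inner_le_norm x (H x))
    have h2 : ‖x‖ * (m * ‖x‖) ≤ ‖x‖ * ‖H x‖ := by linarith [h1]
    exact le_of_mul_le_mul_left h2 h

lemma exists_inverse_of_coercive [FiniteDimensional ℝ V] {H : V →L[ℝ] V} {m : ℝ} (hm : 0 < m)
    (cH : ∀ x, m * ‖x‖ ^ 2 ≤ inner ℝ x (H x)) :
    ∃ K : V →L[ℝ] V, (∀ x, H (K x) = x) ∧ ∀ x, K (H x) = x := by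
  have hinj : Function.Injective (H : V →ₗ[ℝ] V) := by
    rw [← LinearMap.ker_eq_bot, LinearMap.ker_eq_bot']
    intro x hx
    have h1 := norm_le_of_coercive cH x
    have h2 : H x = 0 := hx
    rw [h2, norm_zero] at h1
    exact norm_le_zero_iff.1 (nonpos_of_mul_nonpos_right h1 hm)
  let e := LinearEquiv.ofInjectiveEndo (H : V →ₗ[ℝ] V) hinj
  exact ⟨LinearMap.toContinuousLinearMap (e.symm : V →ₗ[ℝ] V), fun x => e.apply_symm_apply x,
    fun x => e.symm_apply_apply x⟩

lemma inner_inverse_comm {H K : V →L[ℝ] V} (hH : ∀ x y, inner ℝ (H x) y = inner ℝ x (H y))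
    (hHK : ∀ x, H (K x) = x) (x y : V) : inner ℝ (K x) y = inner ℝ x (K y) := by
  rw [← hHK y, ← hH, hHK, hHK]

/-- The operator `a Z² + c`. -/
noncomputable def sqOp (Z : V →L[ℝ] V) (a c : ℝ) : V →L[ℝ] V := a • (Z * Z) + c • 1

/-- The operator `-(a Z³)`. -/
noncomputable def negCubeOp (Z : V →L[ℝ] V) (a : ℝ) : V →L[ℝ] V := -(a • (Z * Z * Z))

@[simp]
lemma sqOp_apply (Z : V →L[ℝ] V) (a c : ℝ) (x : V) : sqOp Z a c x = a • Z (Z x) + c • x := rfl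

@[simp]
lemma negCubeOp_apply (Z : V →L[ℝ] V) (a : ℝ) (x : V) : negCubeOp Z a x = -(a • Z (Z (Z x))) := rfl

variable {Z K : V →L[ℝ] V}

lemma inner_sqOp_comm (hZ : ∀ x y, inner ℝ (Z x) y = inner ℝ x (Z y)) (a c : ℝ) (x y : V) :
    inner ℝ (sqOp Z a c x) y = inner ℝ x (sqOp Z a c y) := by
  simp [inner_add_left, inner_add_right, inner_smul_left, inner_smul_right, hZ]

lemma inner_negCubeOp_comm (hZ : ∀ x y, inner ℝ (Z x) y = inner ℝ x (Z y)) (a : ℝ) (x y : V) :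
    inner ℝ (negCubeOp Z a x) y = inner ℝ x (negCubeOp Z a y) := by
  simp [inner_smul_left, inner_smul_right, hZ]

lemma inner_sqOp_self (hZ : ∀ x y, inner ℝ (Z x) y = inner ℝ x (Z y)) (a c : ℝ) (x : V) :
    inner ℝ x (sqOp Z a c x) = a * ‖Z x‖ ^ 2 + c * ‖x‖ ^ 2 := by
  rw [sqOp_apply, inner_add_right, inner_smul_right, inner_smul_right, ← hZ,
    real_inner_self_eq_norm_sq, real_inner_self_eq_norm_sq]

lemma sqOp_coercive (hZ : ∀ x y, inner ℝ (Z x) y = inner ℝ x (Z y)) {a : ℝ} (ha : 0 ≤ a) (c : ℝ)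
    (x : V) : c * ‖x‖ ^ 2 ≤ inner ℝ x (sqOp Z a c x) := by
  rw [inner_sqOp_self hZ]
  have := mul_nonneg ha (sq_nonneg ‖Z x‖)
  linarith

lemma norm_sqOp_le (nZ : ∀ x, ‖Z x‖ ≤ 2 * ‖x‖) {a c : ℝ} (ha : 0 ≤ a) (hc : 0 ≤ c) (x : V) :
    ‖sqOp Z a c x‖ ≤ (4 * a + c) * ‖x‖ := by
  rw [sqOp_apply]
  refine (norm_add_le _ _).trans ?_
  rw [norm_smul, norm_smul, Real.norm_of_nonneg ha, Real.norm_of_nonneg hc]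
  have h1 : ‖Z (Z x)‖ ≤ 4 * ‖x‖ := by linarith [nZ (Z x), nZ x]
  have h2 := mul_le_mul_of_nonneg_left h1 ha
  linarith

lemma norm_negCubeOp_le (nZ : ∀ x, ‖Z x‖ ≤ 2 * ‖x‖) {a : ℝ} (ha : 0 ≤ a) (x : V) :
    ‖negCubeOp Z a x‖ ≤ 8 * a * ‖x‖ := by
  rw [negCubeOp_apply, norm_neg, norm_smul, Real.norm_of_nonneg ha]
  have h1 : ‖Z (Z (Z x))‖ ≤ 8 * ‖x‖ := by linarith [nZ (Z (Z x)), nZ (Z x), nZ x]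
  have h2 := mul_le_mul_of_nonneg_left h1 ha
  linarith

lemma map_inverse_sqOp {a c : ℝ} (hHK : ∀ x, sqOp Z a c (K x) = x) (hKH : ∀ x, K (sqOp Z a c x) = x)
    (x : V) : Z (K x) = K (Z x) := by
  have h : Z (sqOp Z a c (K x)) = sqOp Z a c (Z (K x)) := by simp
  rw [hHK] at h
  rw [h, hKH]

/-- The Hessian of the total objective of the coupled quadratic problem, where `K` is the inverse
of the Hessian of the lower level. -/
noncomputable def totalHess (Z K : V →L[ℝ] V) (α β μx Ly L : ℝ) : V →L[ℝ] V :=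
  sqOp Z α μx - (2 : ℝ) • (negCubeOp Z (α * β / L) * K * ((-(L / 2)) • Z)) +
    ((-(L / 2)) • Z) * K * (Ly • 1) * K * ((-(L / 2)) • Z)

lemma totalHess_apply {α β μx Ly L : ℝ} (hL : L ≠ 0) (x : V) :
    totalHess Z K α β μx Ly L x = sqOp Z α μx x - (α * β) • Z (Z (Z (K (Z x)))) +
      (Ly * L ^ 2 / 4) • Z (K (K (Z x))) := by
  simp only [totalHess, add_apply, sub_apply, smul_apply, mul_apply_eq_comp, one_apply_eq_self,
    map_smul, negCubeOp_apply]
  match_scalars <;> field_simp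
  ring

variable {α β μx μy Ly L : ℝ}

lemma inner_totalHess (hL : L ≠ 0) (hZ : ∀ x y, inner ℝ (Z x) y = inner ℝ x (Z y))
    (hK : ∀ x y, inner ℝ (K x) y = inner ℝ x (K y)) (hZK : ∀ x, Z (K x) = K (Z x)) (x : V) :
    inner ℝ x (totalHess Z K α β μx Ly L x) = α * ‖Z x‖ ^ 2 + μx * ‖x‖ ^ 2
      - α * β * inner ℝ (Z x) (Z (K (Z (Z x)))) + Ly * L ^ 2 / 4 * ‖K (Z x)‖ ^ 2 := by
  rw [totalHess_apply hL, inner_add_right, inner_sub_right, inner_sqOp_self hZ, inner_smul_right,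
    inner_smul_right, ← hZ, ← hZ x, ← hK, real_inner_self_eq_norm_sq, hZK (Z x)]

/-- Since `βZ² ≤ H` and everything commutes, `0 ≤ β Z K Z ≤ 1`. This controls the negative
contribution of `C` to the Hessian of `Φ`. -/
lemma coupling_bounds (hβ : 0 ≤ β) (hμy : 0 < μy) (hZ : ∀ x y, inner ℝ (Z x) y = inner ℝ x (Z y))
    (hHK : ∀ x, sqOp Z β μy (K x) = x) (p : V) :
    0 ≤ inner ℝ p (Z (K (Z p))) ∧ β * inner ℝ p (Z (K (Z p))) ≤ ‖p‖ ^ 2 := by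
  have h1 : inner ℝ p (Z (K (Z p))) = β * ‖Z (K (Z p))‖ ^ 2 + μy * ‖K (Z p)‖ ^ 2 := by
    rw [← inner_sqOp_self hZ, hHK, real_inner_comm, hZ, real_inner_comm, hZ]
  have h2 : 0 ≤ ‖p - β • Z (K (Z p))‖ ^ 2 := sq_nonneg _
  rw [norm_sub_sq_real, inner_smul_right, norm_smul, Real.norm_of_nonneg hβ] at h2
  have h3 : 0 ≤ μy * ‖K (Z p)‖ ^ 2 := by positivity
  have h4 : β * (β * ‖Z (K (Z p))‖ ^ 2) ≤ β * inner ℝ p (Z (K (Z p))) :=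
    mul_le_mul_of_nonneg_left (by linarith) hβ
  refine ⟨by rw [h1]; positivity, by nlinarith⟩

/-- The negative term is at most `α‖Zx‖²` by `coupling_bounds`, so `αZ²` absorbs it and `μx`
survives. -/
lemma totalHess_coercive (hL : L ≠ 0) (hα : 0 ≤ α) (hβ : 0 ≤ β) (hμy : 0 < μy) (hLy : 0 ≤ Ly)
    (hZ : ∀ x y, inner ℝ (Z x) y = inner ℝ x (Z y)) (hHK : ∀ x, sqOp Z β μy (K x) = x)
    (hK : ∀ x y, inner ℝ (K x) y = inner ℝ x (K y)) (hZK : ∀ x, Z (K x) = K (Z x)) (x : V) :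
    μx * ‖x‖ ^ 2 ≤ inner ℝ x (totalHess Z K α β μx Ly L x) := by
  rw [inner_totalHess hL hZ hK hZK]
  have h1 := mul_le_mul_of_nonneg_left (coupling_bounds hβ hμy hZ hHK (Z x)).2 hα
  have h2 : 0 ≤ Ly * L ^ 2 / 4 * ‖K (Z x)‖ ^ 2 := by positivity
  linarith

lemma inner_totalHess_le (hL : L ≠ 0) (hα : 0 ≤ α) (hβ : 0 ≤ β) (hμy : 0 < μy) (hLy : 0 ≤ Ly)
    (nZ : ∀ x, ‖Z x‖ ≤ 2 * ‖x‖)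
    (hZ : ∀ x y, inner ℝ (Z x) y = inner ℝ x (Z y)) (hHK : ∀ x, sqOp Z β μy (K x) = x)
    (hK : ∀ x y, inner ℝ (K x) y = inner ℝ x (K y)) (hZK : ∀ x, Z (K x) = K (Z x)) (x : V) :
    inner ℝ x (totalHess Z K α β μx Ly L x) ≤ (4 * α + μx + Ly * L ^ 2 / μy ^ 2) * ‖x‖ ^ 2 := by
  rw [inner_totalHess hL hZ hK hZK]
  have h1 : ‖Z x‖ ^ 2 ≤ (2 * ‖x‖) ^ 2 := pow_le_pow_left₀ (norm_nonneg _) (nZ x) 2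
  have h2 := mul_le_mul_of_nonneg_left h1 hα
  have h3 := mul_nonneg (mul_nonneg hα hβ) (coupling_bounds hβ hμy hZ hHK (Z x)).1
  have h4 : μy * ‖K (Z x)‖ ≤ ‖Z x‖ := by
    have := norm_le_of_coercive (sqOp_coercive hZ hβ μy) (K (Z x))
    rwa [hHK] at this
  have h5 : ‖K (Z x)‖ ≤ 2 * ‖x‖ / μy := by
    rw [le_div_iff₀ hμy]
    linarith [nZ x]
  have h6 : ‖K (Z x)‖ ^ 2 ≤ (2 * ‖x‖ / μy) ^ 2 := pow_le_pow_left₀ (norm_nonneg _) h5 2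
  have h7 := mul_le_mul_of_nonneg_left h6 (show 0 ≤ Ly * L ^ 2 / 4 by positivity)
  have h8 : Ly * L ^ 2 / 4 * (2 * ‖x‖ / μy) ^ 2 = Ly * L ^ 2 / μy ^ 2 * ‖x‖ ^ 2 := by
    field_simp
    ring
  linarith

lemma inner_totalHess_comm (hL : L ≠ 0) (hZ : ∀ x y, inner ℝ (Z x) y = inner ℝ x (Z y))
    (hK : ∀ x y, inner ℝ (K x) y = inner ℝ x (K y)) (hZK : ∀ x, Z (K x) = K (Z x)) (x y : V) :
    inner ℝ (totalHess Z K α β μx Ly L x) y = inner ℝ x (totalHess Z K α β μx Ly L y) := by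
  rw [totalHess_apply hL, totalHess_apply hL, inner_add_left, inner_add_right, inner_sub_left,
    inner_sub_right, inner_sqOp_comm hZ]
  simp only [inner_smul_left, inner_smul_right, hZ, hK, hZK, RCLike.conj_to_real]

/-- `H² ∇²Φ = P(Z²)` for a quadratic polynomial `P`. -/
lemma totalHess_eq (hL : L ≠ 0) (hHK : ∀ x, sqOp Z β μy (K x) = x)
    (hKH : ∀ x, K (sqOp Z β μy x) = x) (x : V) :
    totalHess Z K α β μx Ly L x = K (K ((α * β * μy + β ^ 2 * μx) • Z (Z (Z (Z x))) +
      (α * μy ^ 2 + 2 * β * μx * μy + Ly * L ^ 2 / 4) • Z (Z x) + (μx * μy ^ 2) • x)) := by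
  have hZK := map_inverse_sqOp hHK hKH
  -- Writing `x = H²ζ` clears both inverses and leaves an identity between polynomials in `Z`.
  obtain ⟨ζ, rfl⟩ : ∃ ζ, x = sqOp Z β μy (sqOp Z β μy ζ) := ⟨K (K x), by rw [hHK, hHK]⟩
  have h1 : ∀ x, Z (sqOp Z β μy x) = sqOp Z β μy (Z x) := by simp
  rw [totalHess_apply hL]
  simp only [h1, map_add, map_smul, hKH]
  simp only [sqOp_apply, map_add, map_smul]
  module

end CoupledQuadratics

/-! ### Growth of the search spaces along a filtration shifted by `Z²` -/

section SearchSpaces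

variable {V : Type*} [NormedAddCommGroup V] [InnerProductSpace ℝ V]

variable {Z : V →L[ℝ] V} {X : ℕ → Submodule ℝ V} {m n : ℕ} {a α β μx μy Ly L : ℝ} {v b : V}

lemma sqOp_mem (hX : Monotone X) (hS : ∀ m, ∀ x ∈ X m, Z (Z x) ∈ X (m + 1)) (a c : ℝ) {x : V}
    (hx : x ∈ X m) : sqOp Z a c x ∈ X (m + 1) :=
  add_mem (Submodule.smul_mem _ _ (hS m x hx)) (Submodule.smul_mem _ _ (hX m.le_succ hx))

lemma map_sqOp_mem (hX : Monotone X) (hS : ∀ m, ∀ x ∈ X m, Z (Z x) ∈ X (m + 1)) (a c : ℝ) {x : V}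
    (hx : Z x ∈ X m) : Z (sqOp Z a c x) ∈ X (m + 1) := by
  have h : Z (sqOp Z a c x) = sqOp Z a c (Z x) := by simp
  rw [h]
  exact sqOp_mem hX hS a c hx

lemma map_pow_one_sub_sqOp_mem (hX : Monotone X) (hS : ∀ m, ∀ x ∈ X m, Z (Z x) ∈ X (m + 1))
    (a c θ : ℝ) (t : ℕ) {x : V} (hx : Z x ∈ X m) :
    Z (((1 - θ • sqOp Z a c) ^ t) x) ∈ X (m + t) := by
  induction t with
  | zero => simpa using hx
  | succ t ih =>
    rw [pow_succ', mul_apply_eq_comp, sub_apply, one_apply_eq_self, map_sub, smul_apply, map_smul]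
    exact sub_mem (hX (Nat.le_succ _) ih) (Submodule.smul_mem _ _ (map_sqOp_mem hX hS a c ih))

lemma inner_smul_map_comm (hZ : ∀ x y, inner ℝ (Z x) y = inner ℝ x (Z y)) (a : ℝ) (x y : V) :
    inner ℝ ((a • Z) x) y = inner ℝ x ((a • Z) y) := by
  simp [inner_smul_left, inner_smul_right, hZ]

variable [CompleteSpace V]

lemma searchSpaces_succ_fst_le (f g : V → V → ℝ) (T : ℕ) {upd : Set ℕ} {k : ℕ}
    (hk : k + 1 ∈ upd) {W : Submodule ℝ V}
    (h : ∀ i ≤ k, xGenerators f g T (searchSpaces f g T upd i).1 (searchSpaces f g T upd i).2 ⊆ W) :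
    (searchSpaces f g T upd (k + 1)).1 ≤ W := by
  rw [searchSpaces]
  simp only [hk, if_true]
  exact Submodule.span_le.2 (Set.iUnion_subset fun i => h i (Nat.lt_succ_iff.1 i.2))

lemma searchSpaces_succ_fst_of_notMem (f g : V → V → ℝ) (T : ℕ) {upd : Set ℕ} {k : ℕ}
    (hk : k + 1 ∉ upd) : (searchSpaces f g T upd (k + 1)).1 = (searchSpaces f g T upd k).1 := by
  rw [searchSpaces]
  simp only [hk, if_false]

lemma searchSpaces_succ_snd_le (f g : V → V → ℝ) (T : ℕ) {upd : Set ℕ} {k : ℕ}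
    {W : Submodule ℝ V}
    (h : ∀ i ≤ k, yGenerators g (searchSpaces f g T upd i).1 (searchSpaces f g T upd i).2 ⊆ W) :
    (searchSpaces f g T upd (k + 1)).2 ≤ W := by
  rw [searchSpaces]
  exact Submodule.span_le.2 (Set.iUnion_subset fun i => h i (Nat.lt_succ_iff.1 i.2))

variable (hX : Monotone X) (hS : ∀ m, ∀ x ∈ X m, Z (Z x) ∈ X (m + 1))
  (hZ : ∀ x y, inner ℝ (Z x) y = inner ℝ x (Z y)) (hb : Z b ∈ X 2) (hv : Z v ∈ X 3)

include hX hS hZ hb in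
lemma yGenerators_subset {Hx Hy : Submodule ℝ V} (hm : 1 ≤ m) (hHx : Hx ≤ X m)
    (hHy : Hy ≤ (X m).comap (Z : V →ₗ[ℝ] V)) :
    yGenerators (quadLower (sqOp Z β μy) (a • Z) b) Hx Hy ⊆
      (X (m + 1)).comap (Z : V →ₗ[ℝ] V) := by
  rintro w (hw | ⟨x, hx, y, hy, rfl⟩)
  · exact hX m.le_succ (hHy hw)
  · rw [gradY_quadLower (inner_sqOp_comm hZ _ _) (inner_smul_map_comm hZ _)]
    refine add_mem (map_sqOp_mem hX hS _ _ (hHy hy)) (add_mem ?_ (hX (by omega) hb))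
    change Z (a • Z x) ∈ X (m + 1)
    rw [map_smul]
    exact Submodule.smul_mem _ _ (hS m x (hHx hx))

include hX hS hZ hv in
-- The costliest direction is the hypergradient: `Z C x` is a multiple of `Z⁴x` and costs two
-- levels, each of the at most `T` factors `1 - θH` costs one, and the final `J` supplies the `Z` in
-- front.
lemma xGenerators_subset {Hx Hy : Submodule ℝ V} {γ δ : ℝ} (T : ℕ) (hm : 1 ≤ m) (hHx : Hx ≤ X m)
    (hHy : Hy ≤ (X m).comap (Z : V →ₗ[ℝ] V)) :
    xGenerators (quadUpper (sqOp Z α μx) (negCubeOp Z γ) (δ • 1) 0 v)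
      (quadLower (sqOp Z β μy) (a • Z) b) T Hx Hy ⊆ X (m + T + 2) := by
  rintro w (hw | ⟨x, hx, y, hy, rfl⟩ | ⟨t, θ, p, c, z, ht, hp, hc, hz, rfl⟩)
  · exact hX (by omega) (hHx hw)
  · rw [gradX_quadUpper (inner_sqOp_comm hZ _ _), add_zero]
    refine hX (show m + 1 ≤ m + T + 2 by omega) (add_mem (sqOp_mem hX hS _ _ (hHx hx)) ?_)
    exact neg_mem (Submodule.smul_mem _ _ (hS m _ (hHy hy)))
  · rw [gradY_quadUpper (by simp [inner_smul_left, inner_smul_right]) (inner_negCubeOp_comm hZ _),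
      jacXY_quadLower]
    simp only [hessY_quadLower (inner_sqOp_comm hZ β μy) (inner_smul_map_comm hZ a),
      List.ofFn_const, List.prod_replicate]
    refine hX (show m + 2 + t ≤ m + T + 2 by omega) (Submodule.smul_mem _ _
      (map_pow_one_sub_sqOp_mem hX hS _ _ _ _ ?_))
    rw [map_add, map_add]
    refine add_mem ?_ (add_mem ?_ (hX (by omega) hv))
    · change Z (δ • c.2) ∈ X (m + 2)
      rw [map_smul]
      exact Submodule.smul_mem _ _ (hX (by omega) (hHy hc.2))
    · rw [negCubeOp_apply, map_neg, map_smul]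
      exact neg_mem (Submodule.smul_mem _ _ (hS _ _ (hS _ _ (hHx hc.1))))

open scoped Classical in
include hX hS hZ hb hv in
-- The levels start at 1 rather than 0 so that `Z b ∈ X 2` and `Z v ∈ X 3` fit into the levels `m +
-- 1` and `m + 2` from the first iteration on.
lemma searchSpaces_le {γ δ : ℝ} (T : ℕ) (upd : Set ℕ) (k : ℕ) :
    (searchSpaces (quadUpper (sqOp Z α μx) (negCubeOp Z γ) (δ • 1) 0 v)
      (quadLower (sqOp Z β μy) (a • Z) b) T upd k).1 ≤
        X (1 + k + (T + 1) * ((Finset.Icc 1 k).filter (· ∈ upd)).card) ∧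
    (searchSpaces (quadUpper (sqOp Z α μx) (negCubeOp Z γ) (δ • 1) 0 v)
      (quadLower (sqOp Z β μy) (a • Z) b) T upd k).2 ≤
        (X (1 + k + (T + 1) * ((Finset.Icc 1 k).filter (· ∈ upd)).card)).comap
          (Z : V →ₗ[ℝ] V) := by
  induction k using Nat.strong_induction_on with
  | _ k ih =>
  rcases k with _ | k
  · rw [searchSpaces]
    exact ⟨bot_le, bot_le⟩
  have hcard : ∀ i ≤ k, ((Finset.Icc 1 i).filter (· ∈ upd)).card ≤
      ((Finset.Icc 1 k).filter (· ∈ upd)).card := fun i hi =>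
    Finset.card_le_card (Finset.filter_subset_filter _ (Finset.Icc_subset_Icc le_rfl hi))
  have hlev : ∀ i ≤ k, 1 + i + (T + 1) * ((Finset.Icc 1 i).filter (· ∈ upd)).card ≤
      1 + k + (T + 1) * ((Finset.Icc 1 k).filter (· ∈ upd)).card := fun i hi =>
    add_le_add (by omega) (Nat.mul_le_mul_left _ (hcard i hi))
  have hx : ∀ i ≤ k, _ := fun i hi => (ih i (by omega)).1.trans (hX (hlev i hi))
  have hy : ∀ i ≤ k, _ := fun i hi =>
    (ih i (by omega)).2.trans (Submodule.comap_mono (hX (hlev i hi)))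
  have hsucc : ((Finset.Icc 1 (k + 1)).filter (· ∈ upd)).card =
      ((Finset.Icc 1 k).filter (· ∈ upd)).card + if k + 1 ∈ upd then 1 else 0 := by
    rw [← Finset.insert_Icc_right_eq_Icc_add_one (by omega), Finset.filter_insert]
    split_ifs with h
    · rw [Finset.card_insert_of_notMem (by simp)]
    · rfl
  constructor
  · by_cases hk : k + 1 ∈ upd
    · refine searchSpaces_succ_fst_le _ _ _ hk fun i hi => (xGenerators_subset hX hS hZ hv T
        (by omega) (hx i hi) (hy i hi)).trans (hX ?_)
      rw [hsucc, if_pos hk, mul_add]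
      omega
    · rw [searchSpaces_succ_fst_of_notMem _ _ _ hk]
      refine (hx k le_rfl).trans (hX ?_)
      rw [hsucc, if_neg hk, add_zero]
      omega
  · refine searchSpaces_succ_snd_le _ _ _ fun i hi => (yGenerators_subset hX hS hZ hb
        (by omega) (hx i hi) (hy i hi)).trans (Submodule.comap_mono (hX ?_))
    rw [hsucc, mul_add]
    omega

include hX hS hZ hb hv in
lemma outputSpace_le {γ δ : ℝ} (S : AlgorithmSchedule) :
    S.outputSpace (quadUpper (sqOp Z α μx) (negCubeOp Z γ) (δ • 1) 0 v)
      (quadLower (sqOp Z β μy) (a • Z) b) ≤ X (S.M - 1) := by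
  classical
  obtain ⟨U, hU⟩ : ∃ U, U = Set.range S.s := ⟨_, rfl⟩
  rw [AlgorithmSchedule.outputSpace, ← hU]
  refine (searchSpaces_le hX hS hZ hb hv S.T U S.K).1.trans (hX ?_)
  -- Only an inequality: an update scheduled at iteration 0 has no effect on the spaces.
  have h : ((Finset.Icc 1 S.K).filter (· ∈ U)).card ≤ S.Q := by
    have h1 : (Finset.Icc 1 S.K).filter (· ∈ U) ⊆ Finset.univ.image S.s := by
      intro i hi
      have hi' := (Finset.mem_filter.1 hi).2
      rw [hU] at hi'
      obtain ⟨j, hj⟩ := hi'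
      exact Finset.mem_image.2 ⟨j, Finset.mem_univ _, hj⟩
    calc _ ≤ _ := Finset.card_le_card h1
      _ ≤ _ := Finset.card_image_le
      _ = S.Q := by simp
  have h2 := Nat.mul_le_mul_left (S.T + 1) h
  have h3 : (S.T + 1) * S.Q = S.Q * S.T + S.Q := by ring
  rw [AlgorithmSchedule.M]
  omega

end SearchSpaces

/-! ### The coupling matrix in coordinates and the decaying solution -/

section CouplingMatrix

variable {d : ℕ}

/-- The coordinates of a vector, extended by zero. -/
noncomputable def coord (x : EuclideanSpace ℝ (Fin d)) (n : ℕ) : ℝ :=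
  if h : n < d then x ⟨n, h⟩ else 0

lemma coord_of_le (x : EuclideanSpace ℝ (Fin d)) {n : ℕ} (h : d ≤ n) : coord x n = 0 :=
  dif_neg (not_lt.2 h)

@[simp]
lemma coord_fin (x : EuclideanSpace ℝ (Fin d)) (i : Fin d) : coord x i = x i := dif_pos i.2

lemma ext_coord {x y : EuclideanSpace ℝ (Fin d)} (h : ∀ n < d, coord x n = coord y n) : x = y := by
  ext i
  simpa using h i i.2

@[simp]
lemma coord_add (x y : EuclideanSpace ℝ (Fin d)) (n : ℕ) :
    coord (x + y) n = coord x n + coord y n := by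
  unfold coord
  split_ifs <;> simp

@[simp]
lemma coord_sub (x y : EuclideanSpace ℝ (Fin d)) (n : ℕ) :
    coord (x - y) n = coord x n - coord y n := by
  unfold coord
  split_ifs <;> simp

@[simp]
lemma coord_smul (c : ℝ) (x : EuclideanSpace ℝ (Fin d)) (n : ℕ) :
    coord (c • x) n = c * coord x n := by
  unfold coord
  split_ifs <;> simp

lemma coord_toLp (F : ℕ → ℝ) {n : ℕ} (h : n < d) :
    coord (WithLp.toLp 2 fun i : Fin d => F i) n = F n := dif_pos h

lemma norm_sq_eq_sum_coord (x : EuclideanSpace ℝ (Fin d)) :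
    ‖x‖ ^ 2 = ∑ n ∈ Finset.range d, coord x n ^ 2 := by
  rw [EuclideanSpace.real_norm_sq_eq, Finset.sum_range]
  simp

/-- The coupling matrix as an operator on `ℝ^d`. -/
noncomputable def couplingCLM (d : ℕ) :
    EuclideanSpace ℝ (Fin d) →L[ℝ] EuclideanSpace ℝ (Fin d) :=
  Matrix.toEuclideanCLM (n := Fin d) (𝕜 := ℝ) (couplingMatrix d)

lemma couplingOp_apply (p : Polynomial ℝ) (x : EuclideanSpace ℝ (Fin d)) :
    couplingOp d p x = Polynomial.aeval (couplingCLM d) p x := by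
  have h : Polynomial.aeval (couplingCLM d) p = Matrix.toEuclideanCLM (n := Fin d) (𝕜 := ℝ)
      (Polynomial.aeval (couplingMatrix d) p) :=
    Polynomial.aeval_algHom_apply
      (Matrix.toEuclideanCLM (n := Fin d) (𝕜 := ℝ)).toAlgEquiv.toAlgHom (couplingMatrix d) p
  rw [h]
  rfl

lemma inner_couplingCLM_comm (x y : EuclideanSpace ℝ (Fin d)) :
    inner ℝ (couplingCLM d x) y = inner ℝ x (couplingCLM d y) := by
  have h : (couplingMatrix d).IsHermitian := by
    ext i j
    simp only [couplingMatrix, Matrix.conjTranspose_apply, Matrix.of_apply, star_trivial,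
      add_comm (j : ℕ)]
  exact Matrix.isSymmetric_toEuclideanLin_iff.2 h x y

lemma sum_ite_coord (x : EuclideanSpace ℝ (Fin d)) (n : ℕ) :
    ∑ j : Fin d, (if (j : ℕ) = n then x j else 0) = coord x n := by
  by_cases h : n < d
  · rw [coord, dif_pos h, Finset.sum_eq_single (⟨n, h⟩ : Fin d)]
    · simp
    · intro j _ hj
      exact if_neg fun h' => hj (Fin.ext h')
    · simp
  · rw [coord, dif_neg h]
    exact Finset.sum_eq_zero fun j _ => if_neg (by omega)

lemma coord_couplingCLM (x : EuclideanSpace ℝ (Fin d)) {n : ℕ} (hn : n < d) :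
    coord (couplingCLM d x) n = coord x (d - 1 - n) - coord x (d - n) := by
  rw [coord, dif_pos hn, ← sum_ite_coord x, ← sum_ite_coord x, ← Finset.sum_sub_distrib]
  change ∑ j, couplingMatrix d ⟨n, hn⟩ j * x j = _
  refine Finset.sum_congr rfl fun j _ => ?_
  simp only [couplingMatrix, Matrix.of_apply]
  have h1 : n + (j : ℕ) + 1 = d ↔ (j : ℕ) = d - 1 - n := by omega
  have h2 : n + (j : ℕ) = d ↔ (j : ℕ) = d - n := by omega
  simp only [h1, h2]
  split_ifs <;> first | (exfalso; omega) | ring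

/-- Each entry of `Zx` is a difference of two entries of reflected copies of `x`, and `(a - b)² ≤
2a² + 2b²`. -/
lemma norm_couplingCLM_le (x : EuclideanSpace ℝ (Fin d)) : ‖couplingCLM d x‖ ≤ 2 * ‖x‖ := by
  refine le_of_sq_le_sq ?_ (by positivity)
  rw [mul_pow, norm_sq_eq_sum_coord, norm_sq_eq_sum_coord]
  have h1 : ∑ n ∈ Finset.range d, coord x (d - 1 - n) ^ 2 = ∑ n ∈ Finset.range d, coord x n ^ 2 :=
    Finset.sum_range_reflect (fun n => coord x n ^ 2) d
  have h2 : ∑ n ∈ Finset.range d, coord x (d - n) ^ 2 ≤ ∑ n ∈ Finset.range d, coord x n ^ 2 := by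
    have h3 := Finset.sum_range_reflect (fun n => coord x (n + 1) ^ 2) d
    have h4 : ∑ n ∈ Finset.range d, coord x (d - n) ^ 2 =
        ∑ n ∈ Finset.range d, coord x (d - 1 - n + 1) ^ 2 := by
      refine Finset.sum_congr rfl fun n hn => ?_
      rw [show d - n = d - 1 - n + 1 by have := Finset.mem_range.1 hn; omega]
    have h5 := Finset.sum_range_succ' (fun n => coord x n ^ 2) d
    rw [Finset.sum_range_succ, coord_of_le x le_rfl] at h5
    rw [h4, h3]
    nlinarith [sq_nonneg (coord x 0)]
  calc _ ≤ ∑ n ∈ Finset.range d, (2 * coord x (d - 1 - n) ^ 2 + 2 * coord x (d - n) ^ 2) := by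
        refine Finset.sum_le_sum fun n hn => ?_
        rw [coord_couplingCLM x (Finset.mem_range.1 hn)]
        nlinarith [sq_nonneg (coord x (d - 1 - n) + coord x (d - n))]
    _ ≤ _ := by
        rw [Finset.sum_add_distrib, ← Finset.mul_sum, ← Finset.mul_sum, h1]
        linarith

lemma coord_couplingCLM_sq_zero (x : EuclideanSpace ℝ (Fin d)) (hd : 0 < d) :
    coord (couplingCLM d (couplingCLM d x)) 0 = coord x 0 - coord x 1 := by
  rw [coord_couplingCLM _ hd, coord_couplingCLM _ (by omega), coord_of_le _ (by omega : d ≤ d - 0),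
    show d - 1 - (d - 1 - 0) = 0 by omega, show d - (d - 1 - 0) = 1 by omega, sub_zero]

/-- With the zero extension of `coord`, this also covers the last row, where the path has a
Dirichlet end; row 0 is the free end. -/
lemma coord_couplingCLM_sq_succ (x : EuclideanSpace ℝ (Fin d)) {n : ℕ} (hn : n + 1 < d) :
    coord (couplingCLM d (couplingCLM d x)) (n + 1) =
      2 * coord x (n + 1) - coord x (n + 2) - coord x n := by
  rw [coord_couplingCLM _ hn, coord_couplingCLM _ (by omega), coord_couplingCLM _ (by omega),
    show d - 1 - (d - 1 - (n + 1)) = n + 1 by omega, show d - (d - 1 - (n + 1)) = n + 2 by omega,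
    show d - 1 - (d - (n + 1)) = n by omega, show d - (d - (n + 1)) = n + 1 by omega]
  ring

/-- The vectors supported on the first `m` coordinates. -/
noncomputable def prefixSpace (d m : ℕ) : Submodule ℝ (EuclideanSpace ℝ (Fin d)) where
  carrier := {x | ∀ n, m ≤ n → coord x n = 0}
  add_mem' hx hy n hn := by rw [coord_add, hx n hn, hy n hn, add_zero]
  zero_mem' n _ := by simp [coord]
  smul_mem' c x hx n hn := by rw [coord_smul, hx n hn, mul_zero]

lemma prefixSpace_mono : Monotone (prefixSpace d) := fun _ _ h _ hx n hn => hx n (h.trans hn)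

lemma couplingCLM_sq_mem_prefixSpace (m : ℕ) (x : EuclideanSpace ℝ (Fin d))
    (hx : x ∈ prefixSpace d m) : couplingCLM d (couplingCLM d x) ∈ prefixSpace d (m + 1) := by
  intro n hn
  obtain ⟨k, rfl⟩ : ∃ k, n = k + 1 := ⟨n - 1, by omega⟩
  by_cases h : k + 1 < d
  · rw [coord_couplingCLM_sq_succ x h, hx _ (by omega), hx _ (by omega), hx _ (by omega)]
    ring
  · exact coord_of_le _ (not_lt.1 h)

/-- The vector with all entries `1`. -/
noncomputable def onesVec (d : ℕ) : EuclideanSpace ℝ (Fin d) := WithLp.toLp 2 fun _ => 1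

lemma coord_couplingCLM_onesVec {n : ℕ} (hn : n < d) :
    coord (couplingCLM d (onesVec d)) n = if n = 0 then 1 else 0 := by
  have h : ∀ k < d, coord (onesVec d) k = 1 := fun k hk => coord_toLp (fun _ => 1) hk
  rw [coord_couplingCLM _ hn, h _ (by omega)]
  split_ifs with h0
  · rw [coord_of_le _ (by omega), sub_zero]
  · rw [h _ (by omega), sub_self]

lemma couplingCLM_onesVec_mem : couplingCLM d (onesVec d) ∈ prefixSpace d 1 := by
  intro n hn
  by_cases h : n < d
  · rw [coord_couplingCLM_onesVec h, if_neg (by omega)]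
  · exact coord_of_le _ (not_lt.1 h)

/-- The solution of `(Z² + s) x = c e₁` for `(1 - r)² = s r`, which decays like `r ^ i`. -/
noncomputable def decayVec (d : ℕ) (r : ℝ) : EuclideanSpace ℝ (Fin d) :=
  WithLp.toLp 2 fun i => r ^ ((i : ℕ) + 1) - r ^ (2 * d + 1 - (i : ℕ))

/-- At `n = d` the two powers agree and cancel, matching the zero extension. The reflected power is
there to meet this boundary condition. -/
lemma coord_decayVec (r : ℝ) {n : ℕ} (hn : n ≤ d) :
    coord (decayVec d r) n = r ^ (n + 1) - r ^ (2 * d + 1 - n) := by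
  rcases hn.eq_or_lt with rfl | hn
  · rw [coord_of_le _ le_rfl, show 2 * n + 1 - n = n + 1 by omega, sub_self]
  · exact coord_toLp (fun n => r ^ (n + 1) - r ^ (2 * d + 1 - n)) hn

/-- In the interior both `r` and `r⁻¹` solve the recurrence `(2 + s)xₙ = xₙ₊₁ + xₙ₋₁`, because `(1 -
r)² = s r`; only the free end leaves a residue. -/
lemma sqOp_decayVec {r s : ℝ} (hr : (1 - r) ^ 2 = s * r) (hd : 0 < d) :
    sqOp (couplingCLM d) 1 s (decayVec d r) =
      ((1 - r) * (1 + r ^ (2 * d + 1))) • couplingCLM d (onesVec d) := by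
  refine ext_coord fun n hn => ?_
  rw [sqOp_apply, coord_add, coord_smul, coord_smul, coord_smul, coord_couplingCLM_onesVec hn]
  rcases n with _ | n
  · rw [coord_couplingCLM_sq_zero _ hd, coord_decayVec r (by omega), coord_decayVec r (by omega),
      show 2 * d + 1 - 1 = 2 * d by omega, if_pos rfl]
    simp only [Nat.sub_zero, pow_succ, pow_zero]
    linear_combination (r ^ (2 * d) - 1) * hr
  · rw [coord_couplingCLM_sq_succ _ hn, coord_decayVec r (by omega), coord_decayVec r (by omega),
      coord_decayVec r (by omega)]
    obtain ⟨e, he⟩ : ∃ e, 2 * d + 1 - (n + 2) = e := ⟨_, rfl⟩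
    rw [he, show 2 * d + 1 - (n + 1) = e + 1 by omega, show 2 * d + 1 - n = e + 2 by omega]
    simp only [pow_succ, Nat.add_eq_zero_iff, one_ne_zero, and_false, if_false]
    linear_combination (r ^ e - r ^ n * r) * hr

end CouplingMatrix

/-! ### Tail estimates for the decaying solution -/

section Decay

lemma nat_mul_pow_le {r : ℝ} (h0 : 0 ≤ r) (h1 : r ≤ 1) (n : ℕ) :
    n * (1 - r) * r ^ n ≤ 1 - r ^ n := by
  induction n with
  | zero => simp
  | succ n ih =>
    have h2 := mul_le_mul_of_nonneg_left ih h0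
    have h3 : (1 - r) * r ^ (n + 1) ≤ (1 - r) * 1 :=
      mul_le_mul_of_nonneg_left (pow_le_one₀ h0 h1) (by linarith)
    have h4 : ((n + 1 : ℕ) : ℝ) * (1 - r) * r ^ (n + 1) =
        r * (n * (1 - r) * r ^ n) + (1 - r) * r ^ (n + 1) := by
      push_cast
      ring
    have h5 : r * (1 - r ^ n) = r - r ^ (n + 1) := by ring
    rw [h4]
    linarith

/-- On expanding the square, the cross term `2 r ^ (2n)` does not depend on `j`. Its total is
controlled by `nat_mul_pow_le`, which leaves at least `1 - 1/100 - 4/10`. -/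
lemma half_le_sum_reflected_decay {r : ℝ} (h0 : 0 < r) (h1 : r < 1) {n : ℕ}
    (hn : r ^ n ≤ 1 / 10) :
    1 / 2 ≤ (1 - r ^ 2) * ∑ j ∈ Finset.range n, (r ^ j * (1 - r ^ (2 * (n - j)))) ^ 2 := by
  have h2 : ∑ j ∈ Finset.range n, ((r ^ 2) ^ j - 2 * r ^ (2 * n)) ≤
      ∑ j ∈ Finset.range n, (r ^ j * (1 - r ^ (2 * (n - j)))) ^ 2 := by
    refine Finset.sum_le_sum fun j hj => ?_
    obtain ⟨k, rfl⟩ := Nat.exists_eq_add_of_le (Finset.mem_range.1 hj).le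
    rw [Nat.add_sub_cancel_left]
    have : (r ^ j * (1 - r ^ (2 * k))) ^ 2 =
        (r ^ 2) ^ j - 2 * r ^ (2 * (j + k)) + (r ^ j * r ^ (2 * k)) ^ 2 := by ring
    rw [this]
    linarith [sq_nonneg (r ^ j * r ^ (2 * k))]
  have h3 : 0 ≤ 1 - r ^ 2 := by nlinarith
  refine le_trans ?_ (mul_le_mul_of_nonneg_left h2 h3)
  rw [Finset.sum_sub_distrib, mul_sub, mul_neg_geom_sum, Finset.sum_const, Finset.card_range,
    nsmul_eq_mul]
  have h4 : 0 < r ^ n := pow_pos h0 n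
  have h5 := nat_mul_pow_le h0.le h1.le n
  have h6 : (1 - r ^ 2) * (n * (2 * r ^ (2 * n))) =
      2 * (1 + r) * r ^ n * (n * (1 - r) * r ^ n) := by ring
  have h7 : 2 * (1 + r) * r ^ n * (n * (1 - r) * r ^ n) ≤ 4 * r ^ n * 1 :=
    mul_le_mul (by nlinarith) (by linarith)
      (mul_nonneg (mul_nonneg (by positivity) (by linarith)) h4.le) (by positivity)
  have h8 : (r ^ 2) ^ n = r ^ n * r ^ n := by ring
  rw [h6, h8]
  nlinarith

variable {d : ℕ}

lemma norm_sq_decayVec_le {r : ℝ} (h0 : 0 < r) (h1 : r < 1) :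
    (1 - r ^ 2) * ‖decayVec d r‖ ^ 2 ≤ 1 := by
  have h3 : 0 ≤ 1 - r ^ 2 := by nlinarith
  have h2 : ‖decayVec d r‖ ^ 2 ≤ ∑ n ∈ Finset.range d, (r ^ 2) ^ n := by
    rw [norm_sq_eq_sum_coord]
    refine Finset.sum_le_sum fun n hn => ?_
    have hn := (Finset.mem_range.1 hn)
    rw [coord_decayVec r hn.le, ← pow_mul, mul_comm 2 n, pow_mul]
    have h5 : r ^ (2 * d + 1 - n) ≤ r ^ (n + 1) := pow_le_pow_of_le_one h0.le h1.le (by omega)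
    have h6 : r ^ (n + 1) ≤ r ^ n := pow_le_pow_of_le_one h0.le h1.le (by omega)
    have h7 : 0 < r ^ (2 * d + 1 - n) := pow_pos h0 _
    exact pow_le_pow_left₀ (by linarith) (by linarith) 2
  refine (mul_le_mul_of_nonneg_left h2 h3).trans ?_
  rw [mul_neg_geom_sum]
  have : 0 < (r ^ 2) ^ d := by positivity
  linarith

lemma norm_sq_sub_decayVec_ge {r : ℝ} (h0 : 0 < r) (h1 : r < 1) {M : ℕ} (hM : 1 ≤ M) (hMd : M ≤ d)
    (hn : r ^ (d + 1 - M) ≤ 1 / 10) (κ : ℝ) {x : EuclideanSpace ℝ (Fin d)}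
    (hx : x ∈ prefixSpace d (M - 1)) :
    1 / 2 * r ^ (2 * M) * ‖κ • decayVec d r‖ ^ 2 ≤ ‖x - κ • decayVec d r‖ ^ 2 := by
  have h2 : (κ * r ^ M) ^ 2 *
      ∑ j ∈ Finset.range (d + 1 - M), (r ^ j * (1 - r ^ (2 * (d + 1 - M - j)))) ^ 2 ≤
      ‖x - κ • decayVec d r‖ ^ 2 := by
    rw [norm_sq_eq_sum_coord, Finset.range_eq_Ico d,
      ← Finset.sum_Ico_consecutive _ (Nat.zero_le (M - 1)) (by omega : M - 1 ≤ d),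
      Finset.sum_Ico_eq_sum_range _ (M - 1) d, show d - (M - 1) = d + 1 - M by omega, Finset.mul_sum]
    -- The first `M - 1` coordinates are discarded; on the others `x` vanishes.
    refine le_add_of_nonneg_of_le (Finset.sum_nonneg fun _ _ => sq_nonneg _)
      (Finset.sum_le_sum fun j hj => ?_)
    have hj := Finset.mem_range.1 hj
    rw [coord_sub, coord_smul, hx _ (by omega), coord_decayVec _ (by omega)]
    refine le_of_eq ?_
    rw [show M - 1 + j + 1 = M + j by omega,
      show 2 * d + 1 - (M - 1 + j) = M + j + 2 * (d + 1 - M - j) by omega, pow_add r (M + j)]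
    ring
  have h3 := half_le_sum_reflected_decay h0 h1 hn
  have h4 := norm_sq_decayVec_le (d := d) h0 h1
  have h5 : 0 < 1 - r ^ 2 := by nlinarith
  refine le_trans ?_ h2
  have h6 : ‖decayVec d r‖ ^ 2 ≤
      2 * ∑ j ∈ Finset.range (d + 1 - M), (r ^ j * (1 - r ^ (2 * (d + 1 - M - j)))) ^ 2 := by
    refine le_of_mul_le_mul_left ?_ h5
    linarith
  rw [norm_smul, mul_pow, Real.norm_eq_abs, sq_abs]
  have h7 := mul_le_mul_of_nonneg_left h6 (sq_nonneg (κ * r ^ M))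
  have h8 : (κ * r ^ M) ^ 2 = κ ^ 2 * r ^ (2 * M) := by ring
  rw [h8] at h7 ⊢
  linarith

lemma decayVec_ne_zero {r : ℝ} (h0 : 0 < r) (h1 : r < 1) (hd : 0 < d) : decayVec d r ≠ 0 := by
  intro h
  have h2 := coord_decayVec (d := d) r (Nat.zero_le d)
  have h3 : coord (0 : EuclideanSpace ℝ (Fin d)) 0 = 0 := by simp [coord]
  have h4 : r ^ (2 * d + 1 - 0) < r ^ (0 + 1) := pow_lt_pow_right_of_lt_one₀ h0 h1 (by omega)
  rw [h, h3] at h2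
  linarith

end Decay

/-! ### The hard instance -/

section HardInstance

variable {d : ℕ}

lemma isCoupledQuadratic_quad (α μx γ Ly β μy a : ℝ) (u v b : EuclideanSpace ℝ (Fin d)) :
    IsCoupledQuadratic
      (quadUpper (sqOp (couplingCLM d) α μx) (negCubeOp (couplingCLM d) γ) (Ly • 1) u v)
      (quadLower (sqOp (couplingCLM d) β μy) (a • couplingCLM d) b) := by
  open Polynomial in
  have h1 : ∀ (a c : ℝ) (x : EuclideanSpace ℝ (Fin d)),
      couplingOp d (C a * X ^ 2 + C c) x = sqOp (couplingCLM d) a c x := fun a c x => by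
    rw [couplingOp_apply]
    simp [pow_two, Algebra.algebraMap_eq_smul_one]
  have h2 : ∀ (a : ℝ) (x : EuclideanSpace ℝ (Fin d)),
      couplingOp d (-(C a * X ^ 3)) x = negCubeOp (couplingCLM d) a x := fun a x => by
    rw [couplingOp_apply]
    simp [pow_succ, Algebra.algebraMap_eq_smul_one]
  have h3 : ∀ (a : ℝ) (x : EuclideanSpace ℝ (Fin d)),
      couplingOp d (C a) x = (a • (1 : EuclideanSpace ℝ (Fin d) →L[ℝ] _)) x := fun a x => by
    rw [couplingOp_apply]
    simp [Algebra.algebraMap_eq_smul_one]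
  have h4 : ∀ (a : ℝ) (x : EuclideanSpace ℝ (Fin d)),
      couplingOp d (C a * X) x = (a • couplingCLM d) x := fun a x => by
    rw [couplingOp_apply]
    simp [Algebra.algebraMap_eq_smul_one]
  refine ⟨C α * X ^ 2 + C μx, -(C γ * X ^ 3), C Ly, C β * X ^ 2 + C μy, C a * X, u, v, b,
    fun x y => ?_, fun x y => ?_⟩
  · rw [h1, h2, h3, quadUpper]
  · rw [h1, h4, quadLower]

/-- A bilevel problem on which no algorithm converges faster than `r ^ (2 * M)`. -/
lemma exists_hard_instance {Lx Lxy Ly L Lgy μx μy r s k B ρxy ρyy : ℝ}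
    (hLy : 0 < Ly) (hL : 0 < L) (hμx : 0 < μx) (hμxL : μx ≤ Lx) (hμy : 0 < μy)
    (hμyL : μy ≤ Lgy) (hLxy : (Lx - μx) * (Lgy - μy) / (2 * L) ≤ Lxy)
    (hr0 : 0 < r) (hr1 : r < 1) (hrs : (1 - r) ^ 2 = s * r)
    (hk : k * s = μx * μy ^ 2)
    (hsk : ((Lx - μx) / 4 * ((Lgy - μy) / 4) * μy + ((Lgy - μy) / 4) ^ 2 * μx) * s + k =
      (Lx - μx) / 4 * μy ^ 2 + 2 * ((Lgy - μy) / 4) * μx * μy + Ly * L ^ 2 / 4)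
    (hB : 0 < B) (hρxy : 0 ≤ ρxy) (hρyy : 0 ≤ ρyy) (hd : 0 < d) :
    ∃ (f g : EuclideanSpace ℝ (Fin d) → EuclideanSpace ℝ (Fin d) → ℝ)
      (xs : EuclideanSpace ℝ (Fin d)),
      SCSCClass Lx Lxy Ly L Lgy ρxy ρyy μx μy B f g ∧ IsCoupledQuadratic f g ∧
      IsMinOn (totalObjective f g) Set.univ xs ∧
      μx / 2 * B ^ 2 ≤ totalObjective f g 0 - totalObjective f g xs ∧
      totalObjective f g 0 - totalObjective f g xs ≤ (Lx + Ly * L ^ 2 / μy ^ 2) / 2 * B ^ 2 ∧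
      ∀ S : AlgorithmSchedule, S.M ≤ d → r ^ (d + 1 - S.M) ≤ 1 / 10 → ∀ xK ∈ S.outputSpace f g,
        μx / 4 * r ^ (2 * S.M) * B ^ 2 ≤ totalObjective f g xK - totalObjective f g xs := by
  set α := (Lx - μx) / 4 with hα_def
  set β := (Lgy - μy) / 4 with hβ_def
  have hα : 0 ≤ α := by rw [hα_def]; linarith
  have hβ : 0 ≤ β := by rw [hβ_def]; linarith
  set Z := couplingCLM d
  have hZ : ∀ x y, inner ℝ (Z x) y = inner ℝ x (Z y) := inner_couplingCLM_comm
  have nZ : ∀ x, ‖Z x‖ ≤ 2 * ‖x‖ := norm_couplingCLM_le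
  have cH := sqOp_coercive hZ hβ μy
  have hH := inner_sqOp_comm hZ β μy
  obtain ⟨K, hHK, hKH⟩ := exists_inverse_of_coercive hμy cH
  have hK := inner_inverse_comm hH hHK
  have hZK := map_inverse_sqOp hHK hKH
  -- This scaling gives the minimiser norm `B`.
  set κ := B / ‖decayVec d r‖ with hκ
  set xs := κ • decayVec d r with hxs
  have hne := norm_pos_iff.2 (decayVec_ne_zero hr0 hr1 hd)
  have hxsB : ‖xs‖ = B := by
    rw [hxs, norm_smul, Real.norm_of_nonneg (by positivity), hκ]
    field_simp
  set ω := κ * ((1 - r) * (1 + r ^ (2 * d + 1))) with hω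
  set q := α * β * μy + β ^ 2 * μx with hq
  -- The factor `qZ² + k` of `P(Z²)` is put into `b`, so that it cancels from the stationarity
  -- equation and `(Z² + s) xs = ω Z 1` remains.
  obtain ⟨b, hb⟩ : ∃ b, b = (2 * ω / (Ly * L)) • sqOp Z q k (onesVec d) := ⟨_, rfl⟩
  -- This `v` makes the terms `C K b` and `J K v` of the gradient of `Φ` cancel.
  obtain ⟨v, hv⟩ : ∃ v, v = (-(2 * α * β / L ^ 2)) • Z (Z b) := ⟨_, rfl⟩
  have hP : (α * β * μy + β ^ 2 * μx) • Z (Z (Z (Z xs))) +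
      (α * μy ^ 2 + 2 * β * μx * μy + Ly * L ^ 2 / 4) • Z (Z xs) + (μx * μy ^ 2) • xs =
      (Ly * L / 2) • Z b := by
    have h1 : sqOp Z 1 s xs = ω • Z (onesVec d) := by
      rw [hxs, map_smul, sqOp_decayVec hrs hd, smul_smul]
    have h2 : sqOp Z q k (sqOp Z 1 s xs) = (Ly * L / 2) • Z b := by
      rw [h1, hb]
      simp only [map_smul, sqOp_apply, map_add, smul_smul, smul_add]
      match_scalars <;> field_simp
    rw [← h2, ← hsk, ← hk]
    simp only [map_smul, sqOp_apply, map_add, one_smul]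
    module
  have hEs : ∀ x y : EuclideanSpace ℝ (Fin d),
      inner ℝ ((Ly • (1 : EuclideanSpace ℝ (Fin d) →L[ℝ] EuclideanSpace ℝ (Fin d))) x) y =
      inner ℝ x ((Ly • (1 : EuclideanSpace ℝ (Fin d) →L[ℝ] EuclideanSpace ℝ (Fin d))) y) := by
    simp [inner_smul_left, inner_smul_right]
  have hJ := inner_smul_map_comm hZ (-(L / 2))
  have hstat : totalHess Z K α β μx Ly L xs + (0 - negCubeOp Z (α * β / L) (K b) +
      ((-(L / 2)) • Z) (K ((Ly • (1 : EuclideanSpace ℝ (Fin d) →L[ℝ] _)) (K b))) -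
      ((-(L / 2)) • Z) (K v)) = 0 := by
    rw [totalHess_eq hL.ne' hHK hKH, hP, hv]
    simp only [smul_apply, one_apply_eq_self, map_smul, negCubeOp_apply, hZK]
    match_scalars <;> field_simp <;> ring
  have hΦ := totalObjective_quad (A := sqOp Z α μx) (C := negCubeOp Z (α * β / L)) (u := 0) (v := v)
    (b := b) hH hJ hμy cH hHK hEs hK
  have hT := inner_totalHess_comm (α := α) (β := β) (μx := μx) (Ly := Ly) hL.ne' hZ hK hZK
  have cT := totalHess_coercive (α := α) (μx := μx) (Ly := Ly) hL.ne' hα hβ hμy hLy.le hZ hHK hK hZK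
  have uT := inner_totalHess_le (α := α) (μx := μx) (Ly := Ly) hL.ne' hα hβ hμy hLy.le nZ hZ hHK
    hK hZK
  have hgap := quadFun_sub_quadFun hT hstat
    (1 / 2 * inner ℝ (K b) ((Ly • (1 : EuclideanSpace ℝ (Fin d) →L[ℝ] _)) (K b)) - inner ℝ v (K b))
  have hmin := (isMinOn_quadFun_iff hT hμx cT hstat (1 / 2 * inner ℝ (K b)
    ((Ly • (1 : EuclideanSpace ℝ (Fin d) →L[ℝ] _)) (K b)) - inner ℝ v (K b)) xs).2 rfl
  change totalObjective _ _ = quadFun (totalHess Z K α β μx Ly L) _ _ at hΦ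
  rw [← hΦ] at hgap hmin
  have hZb : Z b ∈ prefixSpace d 2 := by
    rw [hb, map_smul]
    exact Submodule.smul_mem _ _ (map_sqOp_mem prefixSpace_mono couplingCLM_sq_mem_prefixSpace q k
      couplingCLM_onesVec_mem)
  have hZv : Z v ∈ prefixSpace d 3 := by
    rw [hv, map_smul]
    exact Submodule.smul_mem _ _ (couplingCLM_sq_mem_prefixSpace 2 _ hZb)
  refine ⟨_, _, xs, ?_, isCoupledQuadratic_quad α μx (α * β / L) Ly β μy (-(L / 2)) 0 v b, hmin,
    ?_, ?_, ?_⟩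
  · rw [← hxsB]
    refine quad_memSCSCClass (inner_sqOp_comm hZ _ _) (inner_negCubeOp_comm hZ _) hEs hH hJ
      (fun x => ?_) (fun x => ?_) (fun x => ?_) (fun x => ?_) (fun x => ?_) hρxy hρyy cH hΦ cT hmin
    · refine (norm_sqOp_le nZ hα hμx.le x).trans_eq ?_
      rw [hα_def]
      ring
    -- Here the lower bound on `Lxy` enters: `8αβ/L` equals `(Lx - μx)(Lgy - μy)/(2L)`.
    · refine (norm_negCubeOp_le nZ (by positivity) x).trans
        (mul_le_mul_of_nonneg_right (le_trans (le_of_eq ?_) hLxy) (norm_nonneg x))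
      rw [hα_def, hβ_def]
      field_simp
      ring
    · rw [smul_apply, one_apply_eq_self, norm_smul, Real.norm_of_nonneg hLy.le]
    · refine (norm_sqOp_le nZ hβ hμy.le x).trans_eq ?_
      rw [hβ_def]
      ring
    · rw [smul_apply, norm_smul, norm_neg, Real.norm_of_nonneg (by positivity)]
      nlinarith [nZ x]
  · rw [hgap, zero_sub]
    have := cT (-xs)
    rw [norm_neg, hxsB] at this
    linarith
  · rw [hgap, zero_sub]
    have := uT (-xs)
    rw [norm_neg, hxsB, hα_def] at this
    linarith
  · intro S hS hrS x hx
    have hx' := outputSpace_le prefixSpace_mono couplingCLM_sq_mem_prefixSpace hZ hZb hZv S hx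
    have hM : 1 ≤ S.M := by
      rw [AlgorithmSchedule.M]
      omega
    have h1 := norm_sq_sub_decayVec_ge hr0 hr1 hM hS hrS κ hx'
    rw [← hxs, hxsB] at h1
    rw [hgap]
    have h2 := mul_le_mul_of_nonneg_left h1 hμx.le
    linarith [cT (x - xs)]

end HardInstance

/-! ### The rate `r` and the logarithmic bound -/

section Rate

lemma exists_quadratic_root {q l c : ℝ} (hl : 0 < l) (hc : 0 < c)
    (hD : 4 * q * c < l ^ 2) :
    ∃ s k : ℝ, 0 < s ∧ k * s = c ∧ q * s + k = l ∧ s < 2 * c / l := by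
  have hw : 0 < Real.sqrt (l ^ 2 - 4 * q * c) := Real.sqrt_pos.2 (by linarith)
  have hw2 := Real.sq_sqrt (show 0 ≤ l ^ 2 - 4 * q * c by linarith)
  set w := Real.sqrt (l ^ 2 - 4 * q * c)
  -- The root is written with `l + w` in the denominator so that `q = 0` is allowed.
  refine ⟨2 * c / (l + w), (l + w) / 2, by positivity, by field_simp, ?_, ?_⟩
  · field_simp
    linear_combination hw2
  · exact div_lt_div_of_pos_left (by positivity) hl (by linarith)

/-- With `r = exp (-2t)`, the equation reads `2 sinh t = √s`, and `t ≤ sinh t` gives the logarithmic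
bound. -/
lemma exists_decay_rate {s : ℝ} (hs : 0 < s) :
    ∃ r : ℝ, 0 < r ∧ r < 1 ∧ (1 - r) ^ 2 = s * r ∧ -Real.log r ≤ Real.sqrt s := by
  have ht : 0 < Real.arsinh (Real.sqrt s / 2) :=
    Real.arsinh_pos_iff.2 (by have := Real.sqrt_pos.2 hs; positivity)
  have hsinh := Real.sinh_arsinh (Real.sqrt s / 2)
  have hle := Real.self_le_sinh_iff.2 ht.le
  set t := Real.arsinh (Real.sqrt s / 2)
  refine ⟨Real.exp (-t) ^ 2, by positivity, ?_, ?_, ?_⟩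
  · exact pow_lt_one₀ (Real.exp_pos _).le (Real.exp_lt_one_iff.2 (by linarith)) two_ne_zero
  · have h1 : Real.exp t * Real.exp (-t) = 1 := by rw [← Real.exp_add, add_neg_cancel, Real.exp_zero]
    have h2 : 1 - Real.exp (-t) ^ 2 = Real.sqrt s * Real.exp (-t) := by
      rw [Real.sinh_eq] at hsinh
      linear_combination 2 * Real.exp (-t) * hsinh - h1
    rw [h2, mul_pow, Real.sq_sqrt hs.le]
  · rw [Real.log_pow, Real.log_exp]
    push_cast
    linarith

/-- From `1/s = r/(1 - r)²` one gets `1/s + 1/4 = ((1 + r)/(2(1 - r)))²`, whose root plus `1/2` is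
`1/(1 - r)`; moreover `ξ < 1/s`. -/
lemma rate_gt {r s ξ : ℝ} (hr0 : 0 < r) (hr1 : r < 1) (hrs : (1 - r) ^ 2 = s * r) (hξ : 0 < ξ)
    (hs : s < 1 / ξ) : 1 - (1 / 2 + Real.sqrt (ξ + 1 / 4))⁻¹ < r := by
  have h1 : ξ * s < 1 := by
    rw [lt_div_iff₀ hξ] at hs
    linarith
  have h2 : (ξ + 1 / 4) < ((1 + r) / (2 * (1 - r))) ^ 2 := by
    have h3 : 0 < 1 - r := by linarith
    rw [div_pow, lt_div_iff₀ (by positivity), mul_pow]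
    nlinarith
  have h3 : Real.sqrt (ξ + 1 / 4) < (1 + r) / (2 * (1 - r)) :=
    (Real.sqrt_lt' (div_pos (by linarith) (by linarith))).2 h2
  rw [lt_div_iff₀ (by linarith)] at h3
  have h4 : 0 < 1 / 2 + Real.sqrt (ξ + 1 / 4) := by positivity
  have h5 : 1 - r < 1 / (1 / 2 + Real.sqrt (ξ + 1 / 4)) := by
    rw [lt_div_iff₀ h4]
    linarith
  rw [one_div] at h5
  linarith

lemma discriminant_pos {α β μx μy Ly L : ℝ} (hα : 0 ≤ α) (hβ : 0 ≤ β) (hμx : 0 < μx)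
    (hμy : 0 < μy) (hLy : 0 < Ly) (hL : 0 < L) :
    4 * (α * β * μy + β ^ 2 * μx) * (μx * μy ^ 2) <
      (α * μy ^ 2 + 2 * β * μx * μy + Ly * L ^ 2 / 4) ^ 2 := by
  have h1 : 0 < (Ly * L ^ 2 / 4) ^ 2 := by positivity
  have h2 : 0 ≤ 2 * (α * μy ^ 2 + 2 * β * μx * μy) * (Ly * L ^ 2 / 4) := by positivity
  have h3 : (α * μy ^ 2 + 2 * β * μx * μy) ^ 2 =
      4 * (α * β * μy + β ^ 2 * μx) * (μx * μy ^ 2) + (α * μy ^ 2) ^ 2 := by ring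
  nlinarith [sq_nonneg (α * μy ^ 2)]

lemma pow_le_of_logb_lt {r t : ℝ} (hr0 : 0 < r) (hr1 : r < 1) (ht : 0 < t) {d M : ℕ} (hM : M ≤ d)
    (h : (M : ℝ) + 1 + Real.logb r t < d) : r ^ (d + 1 - M) ≤ t := by
  rw [← Real.rpow_natCast]
  refine le_of_le_of_eq ?_ (Real.rpow_logb hr0 hr1.ne ht)
  refine Real.rpow_le_rpow_of_exponent_ge hr0 hr1.le ?_
  push_cast [show M ≤ d + 1 by omega]
  linarith

end Rate

lemma AlgorithmSchedule.complexity_ge (S : AlgorithmSchedule) {τ : ℝ} :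
    min τ 1 * ((S.M : ℝ) - 2) ≤ S.complexity τ := by
  have h1 : (S.M : ℝ) = S.K + (S.Q + S.Q * S.T) + 2 := by
    rw [AlgorithmSchedule.M]
    push_cast
    ring
  rw [h1, AlgorithmSchedule.complexity]
  have h2 := mul_le_mul_of_nonneg_right (min_le_left τ 1)
    (show (0 : ℝ) ≤ S.Q + S.Q * S.T by positivity)
  have h3 := mul_le_mul_of_nonneg_right (min_le_right τ 1) (show (0 : ℝ) ≤ S.K by positivity)
  linarith

/-- The logarithmic lower bound on the complexity that follows from a linear rate of convergence
`r`, once the accuracy is high enough. -/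
lemma mul_log_le_of_rate {r σ σ₀ c X : ℝ} {M : ℕ} (hr0 : 0 < r) (hr1 : r < 1) (hσ₀ : 0 < σ₀)
    (hσ : σ₀ ≤ σ) (hrσ : -Real.log r * σ ≤ 3) (hc : 0 < c) (hX : 0 < X)
    (hXc : 2 * (|Real.log c| + 12 / σ₀) ≤ Real.log X) (h : c * X * r ^ (2 * M) ≤ 1) :
    σ * Real.log X / 12 ≤ M - 2 := by
  have hθ : Real.log r < 0 := Real.log_neg hr0 hr1
  have h1 : Real.log c + Real.log X + 2 * M * Real.log r ≤ 0 := by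
    have := Real.log_le_log (by positivity) h
    rw [Real.log_mul (by positivity) (by positivity), Real.log_mul hc.ne' hX.ne', Real.log_pow,
      Real.log_one] at this
    push_cast at this
    linarith
  have h2 : -Real.log r ≤ 3 / σ₀ := by
    rw [le_div_iff₀ hσ₀]
    nlinarith
  have h3 : 12 / σ₀ = 4 * (3 / σ₀) := by ring
  -- Half of `log X` pays for `|log c|` and for the shift from `M` to `M - 2`, which costs `-4 log r
  -- ≤ 12/σ₀`.
  have h4 : Real.log X / 2 ≤ 2 * (-Real.log r) * (M - 2) := by
    have := neg_abs_le (Real.log c)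
    nlinarith
  have hpos : 0 ≤ Real.log X := le_trans (by positivity) hXc
  have h5 : 0 ≤ (M : ℝ) - 2 := by
    by_contra! h6
    nlinarith
  have h7 := mul_le_mul_of_nonneg_right h4 (hσ₀.le.trans hσ)
  have h8 := mul_le_mul_of_nonneg_right hrσ h5
  nlinarith

/-! ### Assembly of the constants -/

theorem mainTheorem6 (Lx Lxy Ly Lgxy Lgy τ : ℝ)
    (hLx : 0 < Lx) (hLy : 0 < Ly) (hLgxy : 0 < Lgxy) (hLgy : 0 < Lgy) (hτ : 0 < τ) :
    ∃ c₁ c₂ c₃ c₄ c₅ : ℝ, 0 < c₁ ∧ 0 < c₂ ∧ 0 < c₃ ∧ 0 < c₄ ∧ 0 < c₅ ∧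
      ∀ μx μy : ℝ, 0 < μx → μx ≤ Lx → 0 < μy → μy ≤ Lgy →
        (Lx - μx) * (Lgy - μy) / (2 * Lgxy) ≤ Lxy →
        ∃ r ξ : ℝ,
          Lgy / (4 * μy) + Lx / (8 * μx) + Ly * Lgxy ^ 2 / (8 * μx * μy ^ 2) - 3 / 8 ≤ ξ ∧
          c₁ / (μx * μy ^ 2) ≤
            Lgy / (4 * μy) + Lx / (8 * μx) + Ly * Lgxy ^ 2 / (8 * μx * μy ^ 2) - 3 / 8 ∧
          1 - (1 / 2 + Real.sqrt (ξ + 1 / 4))⁻¹ < r ∧ r < 1 ∧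
          ∀ ρxy ρyy B : ℝ, 0 ≤ ρxy → 0 ≤ ρyy → 0 < B →
            ∃ D : ℝ → ℕ, ∀ d : ℕ, 5 ≤ d →
              ∃ (f g : EuclideanSpace ℝ (Fin d) → EuclideanSpace ℝ (Fin d) → ℝ)
                (xs : EuclideanSpace ℝ (Fin d)),
                SCSCClass Lx Lxy Ly Lgxy Lgy ρxy ρyy μx μy B f g ∧
                IsCoupledQuadratic f g ∧
                IsMinOn (totalObjective f g) Set.univ xs ∧
                -- the convergence rate
                (∀ S : AlgorithmSchedule,
                  max (2 * (S.M : ℝ)) ((S.M : ℝ) + 1 + Real.logb r (c₂ * (μx * μy ^ 2))) < (d : ℝ) →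
                  ∀ xK ∈ S.outputSpace f g,
                    c₃ * (μx * μy ^ 2 * (totalObjective f g 0 - totalObjective f g xs)
                        * r ^ (2 * S.M)) ≤
                      totalObjective f g xK - totalObjective f g xs) ∧
                -- the complexity
                (∀ ε : ℝ, 0 < ε → D ε ≤ d →
                  ε ≤ c₄ * (μx * μy ^ 2 * (totalObjective f g 0 - totalObjective f g xs)) →
                  ∀ S : AlgorithmSchedule, ∀ xK ∈ S.outputSpace f g,
                    totalObjective f g xK - totalObjective f g xs ≤ ε →
                    c₅ * (Real.sqrt (Ly * Lgxy ^ 2 / (μx * μy ^ 2))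
                        * Real.log (μx * μy ^ 2 *
                            (totalObjective f g 0 - totalObjective f g xs) / ε)) ≤
                      S.complexity τ) := by

  have hN : 0 < Lx * Lgy ^ 2 + Ly * Lgxy ^ 2 := by positivity
  set N := Lx * Lgy ^ 2 + Ly * Lgxy ^ 2 with hN_def
  set σ₀ := Real.sqrt (Ly * Lgxy ^ 2 / (Lx * Lgy ^ 2)) with hσ₀_def
  have hσ₀ : 0 < σ₀ := Real.sqrt_pos.2 (by positivity)
  have hτ1 : 0 < min τ 1 := lt_min hτ one_pos
  -- The second constant makes `c₂ μx μy² ≤ 1/10`, as the tail estimate needs; the fourth makes `log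
  -- X` large enough for `mul_log_le_of_rate`. Here `σ₀` bounds the square root in the complexity
  -- from below for all admissible `μx`, `μy`.
  refine ⟨Ly * Lgxy ^ 2 / 8, 1 / (10 * (Lx * Lgy ^ 2)), 1 / (2 * N),
    Real.exp (-(2 * (|Real.log (1 / (2 * N))| + 12 / σ₀))), min τ 1 / 12, by positivity,
    by positivity, by positivity, Real.exp_pos _, by positivity, ?_⟩
  intro μx μy hμx hμxL hμy hμyL hLxy
  have hα : 0 ≤ (Lx - μx) / 4 := by linarith
  have hβ : 0 ≤ (Lgy - μy) / 4 := by linarith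
  set c := μx * μy ^ 2 with hc_def
  have hc : 0 < c := by positivity
  have hcL : c ≤ Lx * Lgy ^ 2 := mul_le_mul hμxL (pow_le_pow_left₀ hμy.le hμyL 2) (by positivity)
    hLx.le
  have hl : 0 < (Lx - μx) / 4 * μy ^ 2 + 2 * ((Lgy - μy) / 4) * μx * μy + Ly * Lgxy ^ 2 / 4 := by
    positivity
  obtain ⟨s, k, hs, hk, hsk, hsl⟩ :=
    exists_quadratic_root hl hc (discriminant_pos hα hβ hμx hμy hLy hLgxy)
  obtain ⟨r, hr0, hr1, hrs, hlog⟩ := exists_decay_rate hs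
  set ξ := Lgy / (4 * μy) + Lx / (8 * μx) + Ly * Lgxy ^ 2 / (8 * μx * μy ^ 2) - 3 / 8 with hξ_def
  -- The number `ξ` is `l/(2c)`, with `l` and `c` the linear and constant coefficients of `P`.
  have hξ_eq : 2 * c / ((Lx - μx) / 4 * μy ^ 2 + 2 * ((Lgy - μy) / 4) * μx * μy
      + Ly * Lgxy ^ 2 / 4) = 1 / ξ := by
    have : ξ = ((Lx - μx) / 4 * μy ^ 2 + 2 * ((Lgy - μy) / 4) * μx * μy
      + Ly * Lgxy ^ 2 / 4) / (2 * c) := by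
      rw [hξ_def, hc_def]
      field_simp
      ring
    rw [this, one_div_div]
  rw [hξ_eq] at hsl
  have hξ_ge : Ly * Lgxy ^ 2 / 8 / c ≤ ξ := by
    have h1 : 1 / 4 ≤ Lgy / (4 * μy) := by rw [div_le_div_iff₀ (by norm_num) (by positivity)]; linarith
    have h2 : 1 / 8 ≤ Lx / (8 * μx) := by rw [div_le_div_iff₀ (by norm_num) (by positivity)]; linarith
    have h3 : Ly * Lgxy ^ 2 / 8 / c = Ly * Lgxy ^ 2 / (8 * μx * μy ^ 2) := by
      rw [hc_def, div_div, mul_assoc]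
    rw [h3, hξ_def]
    linarith
  have hξ : 0 < ξ := lt_of_lt_of_le (by positivity) hξ_ge
  refine ⟨r, ξ, le_rfl, hξ_ge, rate_gt hr0 hr1 hrs hξ hsl, hr1, ?_⟩
  intro ρxy ρyy B hρxy hρyy hB
  set σ := Real.sqrt (Ly * Lgxy ^ 2 / c) with hσ_def
  have hσ : σ₀ ≤ σ := Real.sqrt_le_sqrt (div_le_div_of_nonneg_left (by positivity) hc hcL)
  have hσ0 : 0 < σ := hσ₀.trans_le hσ
  have hrσ : -Real.log r * σ ≤ 3 := by
    -- In fact the product is below 8; 9 is a convenient square.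
    have h1 : s * (Ly * Lgxy ^ 2 / c) ≤ 3 ^ 2 := by
      rw [lt_div_iff₀ hξ] at hsl
      have h2 := mul_le_mul_of_nonneg_left hξ_ge hs.le
      have h3 : Ly * Lgxy ^ 2 / 8 / c = Ly * Lgxy ^ 2 / c / 8 := by ring
      rw [h3] at h2
      linarith
    calc -Real.log r * σ ≤ Real.sqrt s * σ := mul_le_mul_of_nonneg_right hlog hσ0.le
      _ = Real.sqrt (s * (Ly * Lgxy ^ 2 / c)) := (Real.sqrt_mul hs.le _).symm
      _ ≤ 3 := Real.sqrt_le_iff.2 ⟨by norm_num, h1⟩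
  have hc₂ : 0 < 1 / (10 * (Lx * Lgy ^ 2)) * c := by positivity
  have hc₂' : 1 / (10 * (Lx * Lgy ^ 2)) * c ≤ 1 / 10 := by
    rw [div_mul_eq_mul_div, div_le_div_iff₀ (by positivity) (by norm_num)]
    linarith
  set ℓ := Real.logb r (1 / (10 * (Lx * Lgy ^ 2)) * c) with hℓ
  set Δ₁ := (Lx + Ly * Lgxy ^ 2 / μy ^ 2) / 2 * B ^ 2 with hΔ₁
  have hΔ₁0 : 0 < Δ₁ := by positivity
  -- `D` precedes `d` and the instance, so it uses the bound `Δ₁` on the initial gap instead of the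
  -- gap itself.
  refine ⟨fun ε => ⌈2 * (σ * (c * Δ₁ / ε) + 2) + |ℓ| + 1⌉₊, fun d hd => ?_⟩
  obtain ⟨f, g, xs, hmem, hquad, hmin, hΔ_ge, hΔ_le, hrate⟩ := exists_hard_instance hLy hLgxy hμx
    hμxL hμy hμyL hLxy hr0 hr1 hrs hk hsk hB hρxy hρyy (show 0 < d by omega)
  set Δ := totalObjective f g 0 - totalObjective f g xs with hΔ_def
  have hΔ : 0 < Δ := lt_of_lt_of_le (by positivity) hΔ_ge
  have hconv : ∀ S : AlgorithmSchedule, max (2 * (S.M : ℝ)) ((S.M : ℝ) + 1 + ℓ) < (d : ℝ) →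
      ∀ xK ∈ S.outputSpace f g, 1 / (2 * N) * (c * Δ * r ^ (2 * S.M)) ≤
        totalObjective f g xK - totalObjective f g xs := by
    intro S hS xK hxK
    have hM : S.M ≤ d := by
      have h1 : (S.M : ℝ) ≤ d := by
        linarith [(le_max_left _ _).trans_lt hS, Nat.cast_nonneg (α := ℝ) S.M]
      exact_mod_cast h1
    refine le_trans ?_ (hrate S hM ((pow_le_of_logb_lt hr0 hr1 hc₂ hM
      ((le_max_right _ _).trans_lt hS)).trans hc₂') xK hxK)
    have h1 : μy ^ 2 * Δ ≤ N / 2 * B ^ 2 := by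
      have h2 : N = μy ^ 2 * (N / μy ^ 2) := by field_simp
      have h3 : Lx + Ly * Lgxy ^ 2 / μy ^ 2 ≤ N / μy ^ 2 := by
        rw [hN_def, add_div]
        have : Lx ≤ Lx * Lgy ^ 2 / μy ^ 2 := by
          rw [le_div_iff₀ (by positivity)]
          exact mul_le_mul_of_nonneg_left (pow_le_pow_left₀ hμy.le hμyL 2) hLx.le
        linarith
      have h4 : Δ ≤ N / μy ^ 2 / 2 * B ^ 2 :=
        hΔ_le.trans (mul_le_mul_of_nonneg_right (by linarith) (sq_nonneg B))
      calc μy ^ 2 * Δ ≤ μy ^ 2 * (N / μy ^ 2 / 2 * B ^ 2) :=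
            mul_le_mul_of_nonneg_left h4 (sq_nonneg _)
        _ = N / 2 * B ^ 2 := by field_simp
    have h2 := mul_le_mul_of_nonneg_left h1
      (show 0 ≤ 1 / (2 * N) * (μx * r ^ (2 * S.M)) by positivity)
    have h3 : 1 / (2 * N) * (μx * r ^ (2 * S.M)) * (N / 2 * B ^ 2) =
        μx / 4 * r ^ (2 * S.M) * B ^ 2 := by
      field_simp
      norm_num
    rw [h3] at h2
    refine le_of_eq_of_le ?_ h2
    rw [hc_def]
    ring
  refine ⟨f, g, xs, hmem, hquad, hmin, hconv, ?_⟩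
  intro ε hε hD hε' S xK hxK hgap
  set X := c * Δ / ε with hX_def
  have hX : 0 < X := by positivity
  suffices h : σ * Real.log X / 12 ≤ S.M - 2 by
    have h1 := mul_le_mul_of_nonneg_left h hτ1.le
    have h2 := S.complexity_ge (τ := τ)
    linarith
  by_cases hS : max (2 * (S.M : ℝ)) ((S.M : ℝ) + 1 + ℓ) < (d : ℝ)
  · refine mul_log_le_of_rate (c := 1 / (2 * N)) hr0 hr1 hσ₀ hσ hrσ (by positivity) hX ?_ ?_
    · rw [Real.le_log_iff_exp_le hX, hX_def, le_div_iff₀ hε]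
      rw [Real.exp_neg] at hε'
      have h1 := Real.exp_pos (2 * (|Real.log (1 / (2 * N))| + 12 / σ₀))
      rw [inv_mul_eq_div, le_div_iff₀ h1] at hε'
      linarith
    · have h1 := (hconv S hS xK hxK).trans hgap
      have h2 : 1 / (2 * N) * X * r ^ (2 * S.M) =
          1 / (2 * N) * (c * Δ * r ^ (2 * S.M)) / ε := by
        rw [hX_def]
        ring
      rw [h2, div_le_one hε]
      exact h1
  -- If the dimension is too small for the rate, then `M` is comparable to `d ≥ D ε`, and `log X ≤
  -- X` already gives the bound.
  · have h1 : 2 * (σ * (c * Δ₁ / ε) + 2) + |ℓ| + 1 ≤ d := (Nat.le_ceil _).trans (by exact_mod_cast hD)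
    have h2 : X ≤ c * Δ₁ / ε :=
      div_le_div_of_nonneg_right (mul_le_mul_of_nonneg_left hΔ_le hc.le) hε.le
    have h3 : Real.log X ≤ X := (Real.log_le_sub_one_of_pos hX).trans (by linarith)
    have h4 : σ * Real.log X ≤ σ * (c * Δ₁ / ε) :=
      mul_le_mul_of_nonneg_left (h3.trans h2) hσ0.le
    have h5 : 0 ≤ σ * (c * Δ₁ / ε) := by positivity
    have h6 := le_abs_self ℓ
    have h7 := abs_nonneg ℓ
    rcases le_max_iff.1 (not_lt.1 hS) with h8 | h8 <;> linarith
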